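/- Rectangular free convolution. Let $\lambda\in(0,1)$, $\rho_1=\lambda/(1+\lambda)$, $\rho_2=1/(1+\lambda)$. A $(\rho_1,\rho_2)$-probability space is a unital complex $*$-algebra $\mathcal A$ with nonzero self-adjoint projections $p_1,p_2$, $p_1p_2=p_2p_1=0$, $p_1+p_2=1$, and tracial states $\varphi_k$ on $p_k\mathcal A p_k$ ($k=1,2$) such that $\rho_k\varphi_k(xy)=\rho_l\varphi_l(yx)$ for all $k,l\in\{1,2\}$, $x\in p_k\mathcal A p_l$, $y\in p_l\mathcal A p_k$. Put $\mathcal D=\mathbb C p_1+\mathbb C p_2$ and $E(x)=\varphi_1(p_1xp_1)p_1+\varphi_2(p_2xp_2)p_2$. Elements $a_1,a_2$ are free with amalgamation over $\mathcal D$ if they lie in $*$-subalgebras $\mathcal B_1,\mathcal B_2\supseteq\mathcal D$ such that $E(x_1\cdots x_m)=0$ whenever $m\ge1$, $x_i\in\mathcal B_{j_i}$, $j_1\ne j_2\ne\cdots\ne j_m$ and $E(x_1)=\cdots=E(x_m)=0$. For compactly supported symmetric probability measures $\mu_1,\mu_2$ on $\mathbb R$, the rectangular free convolution with ratio $\lambda$,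 $\mu_1\boxplus_\lambda\mu_2$, is the compactly supported symmetric probability measure whose $2r$-th moment is $\varphi_1\big(((a_1+a_2)(a_1+a_2)^*)^{r}\big)$ for every integer $r\ge 0$, where $a_1,a_2\in p_1\mathcal A p_2$ are free with amalgamation over $\mathcal D$ in a $(\rho_1,\rho_2)$-probability space and $\varphi_1((a_ia_i^*)^{r})$ is the $2r$-th moment of $\mu_i$ for all $r\ge0$ and $i=1,2$. Proposition. Let $0<\lambda<1$ and $\kappa=2(\lambda(2-\lambda))^{1/2}$. Then $\kappa\in(0,2)$, and the measure $$\tau=\frac{\delta_{-1}+\delta_1}{2}\boxplus_\lambda\frac{\delta_{-1}+\delta_1}{2}$$ exists, has support exactly $$K=[-(2+\kappa)^{1/2},-(2-\kappa)^{1/2}]\cup[(2-\kappa)^{1/2},(2+\kappa)^{1/2}],$$ and is absolutely continuous with respect to Lebesgue measure, with density $$\frac{\left[\kappa^2-(x^2-2)^2\right]^{1/2}}{\pi\lambda|x|(4-x^2)}$$ on $K$ (and $0$ outside $K$). -/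

import Mathlib

open MeasureTheory

/-- A `(ρ₁, …, ρ_d)`-rectangular probability space: a unital complex `*`-algebra `A`, nonzero
self-adjoint projections `p k`, pairwise orthogonal with sum `1`, and tracial states `φ k` on the
corners `p k A p k` with `ρ_k φ_k(xy) = ρ_l φ_l(yx)` for `x ∈ p k A p l`, `y ∈ p l A p k`.
The functional `φ k` is extended to `A` by `φ k x = φ k (p k * x * p k)`, and membership of `x` in
`p k A p l` is written `p k * x * p l = x`. -/
structure RectProbSpace {d : ℕ} (ρ : Fin d → ℝ) (A : Type*) [Ring A] [StarRing A]
    [Algebra ℂ A] [StarModule ℂ A] where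
  p : Fin d → A
  φ : Fin d → A →ₗ[ℂ] ℂ
  p_ne_zero : ∀ k, p k ≠ 0
  p_selfAdjoint : ∀ k, star (p k) = p k
  p_idem : ∀ k, p k * p k = p k
  p_orthogonal : ∀ k l, k ≠ l → p k * p l = 0
  p_sum : ∑ k, p k = 1
  φ_compress : ∀ k x, φ k (p k * x * p k) = φ k x
  φ_unital : ∀ k, φ k (p k) = 1
  φ_pos : ∀ k x, p k * x * p k = x → 0 ≤ (φ k (star x * x)).re ∧ (φ k (star x * x)).im = 0
  φ_tracial : ∀ k x y, p k * x * p k = x → p k * y * p k = y → φ k (x * y) = φ k (y * x)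
  φ_exchange : ∀ k l x y, p k * x * p l = x → p l * y * p k = y →
    (ρ k : ℂ) * φ k (x * y) = (ρ l : ℂ) * φ l (y * x)

namespace RectProbSpace

variable {d : ℕ} {ρ : Fin d → ℝ} {A : Type*} [Ring A] [StarRing A] [Algebra ℂ A] [StarModule ℂ A]

/-- The linear span `D` of the projections. -/
def diagonal (S : RectProbSpace ρ A) : Submodule ℂ A := Submodule.span ℂ (Set.range S.p)

/-- The conditional expectation `E(x) = ∑ₖ φₖ(pₖ x pₖ) pₖ` from `A` to `D`. -/
def condExp (S : RectProbSpace ρ A) (x : A) : A := ∑ k, S.φ k (S.p k * x * S.p k) • S.p k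

/-- A family of `*`-subalgebras containing `D` is free with amalgamation over `D`: every nonempty
product of elements with zero expectation, neighbours being taken from subalgebras of different
index, has zero expectation. A word is a list of pairs (index, element). -/
def FreeSubalgebras (S : RectProbSpace ρ A) {J : Type*} (B : J → StarSubalgebra ℂ A) : Prop :=
  (∀ j, (S.diagonal : Set A) ⊆ B j) ∧
  ∀ w : List (J × A), w ≠ [] → w.IsChain (fun u v => u.1 ≠ v.1) →
    (∀ u ∈ w, u.2 ∈ B u.1 ∧ S.condExp u.2 = 0) → S.condExp (w.map Prod.snd).prod = 0

/-- A family of subsets is free with amalgamation over `D` if the subsets are contained in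
`*`-subalgebras which are free with amalgamation over `D`. -/
def FreeSets (S : RectProbSpace ρ A) {J : Type*} (s : J → Set A) : Prop :=
  ∃ B : J → StarSubalgebra ℂ A, S.FreeSubalgebras B ∧ ∀ j, s j ⊆ B j

end RectProbSpace

/-- Symmetric probability measures on the real line with compact support. -/
structure IsSymmCompactProb (μ : Measure ℝ) : Prop where
  prob : IsProbabilityMeasure μ
  symm : μ.map (fun x => -x) = μ
  compact : IsCompact μ.support

/-- `μ` is the rectangular free convolution with ratio `lam` of `μ₁` and `μ₂`: `μ` is symmetric,
and there are elements `a 0`, `a 1` of `p₁ A p₂`, free with amalgamation over `D` in a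
`(ρ₁, ρ₂)`-probability space with `ρ₁ + ρ₂ = 1` and `ρ₁ / ρ₂ = lam`, such that the even moments of
`μ₁`, `μ₂`, `μ` are `φ₁((a a*)^r)` for `a = a 0`, `a = a 1`, `a = a 0 + a 1` respectively. -/
def IsRectFreeConv (lam : ℝ) (μ₁ μ₂ μ : Measure ℝ) : Prop :=
  IsSymmCompactProb μ₁ ∧ IsSymmCompactProb μ₂ ∧ IsSymmCompactProb μ ∧
  ∃ (A : Type) (_ : Ring A) (_ : StarRing A) (_ : Algebra ℂ A) (_ : StarModule ℂ A)
    (S : RectProbSpace ![lam / (1 + lam), 1 / (1 + lam)] A) (a : Fin 2 → A),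
    (∀ i, S.p 0 * a i * S.p 1 = a i) ∧
    S.FreeSets (fun i => {a i}) ∧
    (∀ r : ℕ, S.φ 0 ((a 0 * star (a 0)) ^ r) = ((∫ x, x ^ (2 * r) ∂μ₁ : ℝ) : ℂ)) ∧
    (∀ r : ℕ, S.φ 0 ((a 1 * star (a 1)) ^ r) = ((∫ x, x ^ (2 * r) ∂μ₂ : ℝ) : ℂ)) ∧
    (∀ r : ℕ, S.φ 0 (((a 0 + a 1) * star (a 0 + a 1)) ^ r) = ((∫ x, x ^ (2 * r) ∂μ : ℝ) : ℂ))

open Classical in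
/-- The rectangular free convolution with ratio `lam` of two compactly supported symmetric
probability measures on the real line (the zero measure if there is none). -/
noncomputable def rectFreeConv (lam : ℝ) (μ₁ μ₂ : Measure ℝ) : Measure ℝ :=
  if h : ∃ μ, IsRectFreeConv lam μ₁ μ₂ μ then h.choose else 0

/-- The symmetric Bernoulli distribution `(δ₋₁ + δ₁) / 2`. -/
noncomputable def symmBernoulli : Measure ℝ :=
  (2 : ENNReal)⁻¹ • (Measure.dirac (-1) + Measure.dirac 1)

/-! The proof tests the convolution against a basis of polynomials in `s = x ^ 2`, on which both the
free model and the candidate measure are easy to evaluate.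

Algebraic side. All even moments of the Bernoulli law are `1`, so `a i * star (a i) - p 0` has
length zero. By Cauchy–Schwarz and the exchange relation, no state sees it
(`nullCon_of_length_zero`). Modulo such elements the `a i` are therefore coisometries. The exchange
relation also gives `star (a i) * a i` the expectation `lam • p 1`. Multiplying a sum of reduced
words in these letters by `(a 0 + a 1) * star (a 0 + a 1)` produces a three-term recursion
(`sum_mul_redWord`), which is the one defining `kestenPoly`. Hence for `n ≥ 1` the `n`-th
polynomial, cut by `p 0`, is a sum of alternating centred words, and freeness makes its state vanish
(`φ_kestenPoly`).

Analytic side. Under `x ^ 2 = 2 + κ * cos θ` the polynomials become combinations of two sines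
divided by `sin θ`. The denominator of the density is `(2 - l) ^ 2 * |1 - r * exp (2iθ)| ^ 2` with
`r = l / (2 - l)`. A contraction argument then shows that the candidate integrates the `n`-th
polynomial to `1` for `n = 0` and to `0` otherwise (`integral_kestenPoly_kestenMeasure`). The
polynomials form a basis, so every realization has the moments of the candidate, and a compactly
supported symmetric measure is determined by its even moments.

Existence. A realization is needed whose subalgebras are genuinely free over the diagonal. In a
tracial `*`-algebra containing a projection `q` of trace `l` and two symmetries, all free, the
matrices with upper right entry `q * e` are free coisometries (`exists_free_coisometries`). Such an
algebra is the Hecke algebra of a free product of three groups of order two, acting on finitely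
supported functions on reduced words. Its quadratic relation for one generator is tuned so that `q`
is an affine function of that generator. -/

/-! ### Kesten polynomials -/

open Polynomial in
/-- The orthogonal polynomials, in the variable `s = x ^ 2`, of the convolution of two symmetric
Bernoulli distributions with ratio `l`. -/
noncomputable def kestenPoly (l : ℝ) : ℕ → ℝ[X]
  | 0 => 1
  | 1 => X - C 2
  | 2 => (X - C 2) ^ 2 - C (2 * l)
  | n + 3 => (X - C 2) * kestenPoly l (n + 2) - C (l * (2 - l)) * kestenPoly l (n + 1)

open Polynomial in
lemma kestenPoly_natDegree_monic (l : ℝ) (n : ℕ) :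
    (kestenPoly l n).natDegree = n ∧ (kestenPoly l n).Monic := by
  induction n using kestenPoly.induct with
  | case1 => simp [kestenPoly]
  | case2 => exact ⟨natDegree_X_sub_C 2, monic_X_sub_C 2⟩
  | case3 =>
    have hm : ((X - C 2 : ℝ[X]) ^ 2).Monic := (monic_X_sub_C 2).pow 2
    have hd : ((X - C 2 : ℝ[X]) ^ 2).natDegree = 2 := by
      rw [(monic_X_sub_C 2).natDegree_pow, natDegree_X_sub_C]
    refine ⟨?_, ?_⟩
    · rw [kestenPoly, natDegree_sub_C, hd]
    · rw [kestenPoly]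
      refine hm.sub_of_left ?_
      rw [degree_eq_natDegree hm.ne_zero, hd]
      exact degree_C_le.trans_lt (by norm_num)
  | case4 n ih2 ih1 =>
    have hm : ((X - C 2 : ℝ[X]) * kestenPoly l (n + 2)).Monic := (monic_X_sub_C 2).mul ih2.2
    have hd : ((X - C 2 : ℝ[X]) * kestenPoly l (n + 2)).natDegree = n + 3 := by
      rw [(monic_X_sub_C 2).natDegree_mul ih2.2, natDegree_X_sub_C, ih2.1]; omega
    have hlt : (C (l * (2 - l)) * kestenPoly l (n + 1)).natDegree
        < ((X - C 2 : ℝ[X]) * kestenPoly l (n + 2)).natDegree := by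
      rw [hd]
      refine (natDegree_C_mul_le _ _).trans_lt ?_
      rw [ih1.1]; omega
    refine ⟨?_, ?_⟩
    · rw [kestenPoly, natDegree_sub_eq_left_of_natDegree_lt hlt, hd]
    · rw [kestenPoly]
      exact hm.sub_of_left (degree_lt_degree hlt)

open Polynomial in
/-- Linear maps which agree on the Kesten polynomials are equal. -/
lemma linearMap_ext_kestenPoly {M : Type*} [AddCommGroup M] [Module ℝ M] (l : ℝ)
    {f g : ℝ[X] →ₗ[ℝ] M} (h : ∀ n, f (kestenPoly l n) = g (kestenPoly l n)) : f = g := by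
  let S : Polynomial.Sequence ℝ :=
    ⟨kestenPoly l, fun n => by
      rw [degree_eq_natDegree (kestenPoly_natDegree_monic l n).2.ne_zero,
        (kestenPoly_natDegree_monic l n).1]⟩
  have hs : Submodule.span ℝ (Set.range S) = ⊤ :=
    S.span fun i => by
      have h1 : (S i).leadingCoeff = 1 := (kestenPoly_natDegree_monic l i).2
      rw [h1]; exact isUnit_one
  refine LinearMap.ext_on_range hs h

/-- As `l * (2 - l) = (κ / 2) ^ 2`, the recursion becomes, after rescaling, the one satisfied by
`sin (n * θ)`. The exceptional constant `2 * l` in degree two fixes the coefficient `l / (2 - l)` of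
the second sine. -/
lemma kestenPoly_eval_mul_sin {l κ : ℝ} (hl1 : l < 1) (hκ : κ ^ 2 = 4 * (l * (2 - l)))
    (θ : ℝ) (n : ℕ) :
    (kestenPoly l (n + 1)).eval (2 + κ * Real.cos θ) * Real.sin θ = (κ / 2) ^ (n + 1) *
      (Real.sin ((n + 2) * θ) - l / (2 - l) * Real.sin (n * θ)) := by
  have h2 : (2 - l) ≠ 0 := by linarith
  induction n using Nat.twoStepInduction with
  | zero =>
    simp only [kestenPoly, Polynomial.eval_sub, Polynomial.eval_X, Polynomial.eval_C]
    simp only [Nat.cast_zero, zero_add, zero_mul, Real.sin_zero, Real.sin_two_mul]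
    ring
  | one =>
    simp only [kestenPoly, Polynomial.eval_sub, Polynomial.eval_X, Polynomial.eval_C,
      Polynomial.eval_pow]
    have h3 : Real.sin ((((1 : ℕ) : ℝ) + 2) * θ) = Real.sin (3 * θ) := by norm_num
    rw [h3, Real.sin_three_mul]
    have hs : Real.sin θ ^ 3 = Real.sin θ * (1 - Real.cos θ ^ 2) := by
      rw [← Real.sin_sq]; ring
    rw [hs, Nat.cast_one, one_mul, div_pow, hκ, add_sub_cancel_left, mul_pow, hκ]
    field_simp
    ring
  | more n ih0 ih1 =>
    have e : kestenPoly l (n + 2 + 1) = (Polynomial.X - Polynomial.C 2) * kestenPoly l (n + 2)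
        - Polynomial.C (l * (2 - l)) * kestenPoly l (n + 1) := by rw [kestenPoly]
    rw [e]
    simp only [Polynomial.eval_sub, Polynomial.eval_mul, Polynomial.eval_X, Polynomial.eval_C]
    have hw : l * (2 - l) = κ ^ 2 / 4 := by rw [hκ]; ring
    have key (x : ℝ) : Real.sin ((x + 2) * θ) =
        2 * Real.cos θ * Real.sin ((x + 1) * θ) - Real.sin (x * θ) := by
      have h1 : (x + 2) * θ = (x + 1) * θ + θ := by ring
      have h2 : x * θ = (x + 1) * θ - θ := by ring
      rw [h1, h2, Real.sin_add, Real.sin_sub]; ring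
    have k1 := key (n + 2)
    have k2 := key n
    push_cast at ih0 ih1 ⊢
    have e1 : ((n : ℝ) + 2 + 1) = n + 1 + 2 := by ring
    rw [e1] at k1
    have e2 : ((2 + κ * Real.cos θ - 2) * Polynomial.eval (2 + κ * Real.cos θ)
        (kestenPoly l (n + 2)) - l * (2 - l) * Polynomial.eval (2 + κ * Real.cos θ)
        (kestenPoly l (n + 1))) * Real.sin θ = κ * Real.cos θ *
        (Polynomial.eval (2 + κ * Real.cos θ) (kestenPoly l (n + 1 + 1)) * Real.sin θ) -
        κ ^ 2 / 4 * (Polynomial.eval (2 + κ * Real.cos θ) (kestenPoly l (n + 1)) * Real.sin θ) := by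
      rw [← hw]; ring
    rw [e2, ih0, ih1, k1, k2]
    ring

/-! ### Trigonometric integrals -/

/-- The lower bound comes from `4 - κ ^ 2 = 4 * (1 - l) ^ 2`. It does not depend on `θ`, which makes
the later bound on the integrals uniform. -/
lemma kesten_denom_pos {l κ : ℝ} (hl1 : l < 1) (hκ : κ ^ 2 = 4 * (l * (2 - l))) (θ : ℝ) :
    4 * (1 - l) ^ 2 ≤ 4 - κ ^ 2 * Real.cos θ ^ 2 ∧ 0 < 4 - κ ^ 2 * Real.cos θ ^ 2 := by
  have h1 : Real.cos θ ^ 2 ≤ 1 := Real.cos_sq_le_one θ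
  have h2 : κ ^ 2 * Real.cos θ ^ 2 ≤ κ ^ 2 * 1 := by gcongr
  have h3 : 0 < (1 - l) ^ 2 := pow_pos (by linarith) 2
  constructor <;> nlinarith

/-- The integral of the `n`-th Kesten polynomial, up to a constant. -/
noncomputable def kestenIntegral (l κ : ℝ) (n : ℕ) : ℝ :=
  ∫ θ in (0 : ℝ)..Real.pi, (Real.sin ((n + 1) * θ) - l / (2 - l) * Real.sin ((n - 1) * θ)) *
    Real.sin θ / (4 - κ ^ 2 * Real.cos θ ^ 2)

lemma intervalIntegrable_kesten {l κ : ℝ} (hl1 : l < 1) (hκ : κ ^ 2 = 4 * (l * (2 - l)))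
    {f : ℝ → ℝ} (hf : Continuous f) (a b : ℝ) :
    IntervalIntegrable (fun θ => f θ / (4 - κ ^ 2 * Real.cos θ ^ 2)) volume a b := by
  refine Continuous.intervalIntegrable ?_ a b
  exact hf.div (by fun_prop) fun θ => (kesten_denom_pos hl1 hκ θ).2.ne'

lemma integral_sin_mul_sin (n : ℕ) :
    ∫ θ in (0 : ℝ)..Real.pi, Real.sin ((n + 1) * θ) * Real.sin θ =
      if n = 0 then Real.pi / 2 else 0 := by
  split_ifs with h
  · subst h
    have : ∀ θ : ℝ, Real.sin (((0 : ℕ) + 1) * θ) * Real.sin θ = Real.sin θ ^ 2 := by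
      intro θ; simp [sq]
    simp_rw [this, integral_sin_sq]
    simp
  · have hn : (n : ℝ) ≠ 0 := by exact_mod_cast h
    have hn2 : (n : ℝ) + 2 ≠ 0 := by positivity
    -- The antiderivative comes from the product-to-sum formula; it vanishes at both endpoints.
    have hd (θ : ℝ) : HasDerivAt
        (fun θ : ℝ => Real.sin (n * θ) / (2 * n) - Real.sin ((n + 2) * θ) / (2 * (n + 2)))
        (Real.sin ((n + 1) * θ) * Real.sin θ) θ := by
      have h1 : HasDerivAt (fun θ : ℝ => (n : ℝ) * θ) n θ := by
        simpa using (hasDerivAt_id θ).const_mul (n : ℝ)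
      have h2 : HasDerivAt (fun θ : ℝ => ((n : ℝ) + 2) * θ) (n + 2) θ := by
        simpa using (hasDerivAt_id θ).const_mul ((n : ℝ) + 2)
      refine ((h1.sin.div_const (2 * n)).sub (h2.sin.div_const (2 * (n + 2)))).congr_deriv ?_
      have e1 : (n : ℝ) * θ = (n + 1) * θ - θ := by ring
      have e2 : ((n : ℝ) + 2) * θ = (n + 1) * θ + θ := by ring
      rw [e1, e2, Real.cos_sub, Real.cos_add]
      field_simp
      ring
    rw [intervalIntegral.integral_eq_sub_of_hasDerivAt (fun θ _ => hd θ)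
      (Continuous.intervalIntegrable (by fun_prop) _ _)]
    have e : ((n : ℝ) + 2) = ((n + 2 : ℕ) : ℝ) := by push_cast; ring
    rw [e, Real.sin_nat_mul_pi, Real.sin_nat_mul_pi]
    simp

/-- With `r = l / (2 - l)` the denominator equals `(2 - l) ^ 2 * (1 - 2 * r * cos (2 * θ) + r ^ 2)`.
The combination on the left produces the same trigonometric factor in the numerator, so it cancels
and only an elementary sine integral remains. -/
lemma kestenIntegral_sub {l κ : ℝ} (hl1 : l < 1) (hκ : κ ^ 2 = 4 * (l * (2 - l))) (n : ℕ) :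
    kestenIntegral l κ n - l / (2 - l) * kestenIntegral l κ (n + 2) =
      if n = 0 then Real.pi / 2 / (2 - l) ^ 2 else 0 := by
  have h2 : (2 - l) ≠ 0 := by linarith
  unfold kestenIntegral
  rw [← intervalIntegral.integral_const_mul, ← intervalIntegral.integral_sub
    (intervalIntegrable_kesten hl1 hκ (by fun_prop) _ _)
    ((intervalIntegrable_kesten hl1 hκ (by fun_prop) _ _).const_mul _)]
  have : ∀ θ : ℝ, (Real.sin ((n + 1) * θ) - l / (2 - l) * Real.sin ((n - 1) * θ)) *
      Real.sin θ / (4 - κ ^ 2 * Real.cos θ ^ 2) - l / (2 - l) *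
      ((Real.sin (((n + 2 : ℕ) + 1) * θ) - l / (2 - l) * Real.sin (((n + 2 : ℕ) - 1) * θ)) *
      Real.sin θ / (4 - κ ^ 2 * Real.cos θ ^ 2)) =
      Real.sin ((n + 1) * θ) * Real.sin θ * ((2 - l) ^ 2)⁻¹ := by
    intro θ
    have hG := (kesten_denom_pos hl1 hκ θ).2
    have e1 : (((n + 2 : ℕ) : ℝ) + 1) * θ = (n + 1) * θ + 2 * θ := by push_cast; ring
    have e2 : (((n + 2 : ℕ) : ℝ) - 1) * θ = (n + 1) * θ := by push_cast; ring
    have e3 : ((n : ℝ) - 1) * θ = (n + 1) * θ - 2 * θ := by ring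
    rw [e1, e2, e3, Real.sin_add, Real.sin_sub, Real.cos_two_mul]
    have hnum : (Real.sin ((n + 1) * θ) - l / (2 - l) *
        (Real.sin ((n + 1) * θ) * (2 * Real.cos θ ^ 2 - 1) -
          Real.cos ((n + 1) * θ) * Real.sin (2 * θ))) - l / (2 - l) *
        ((Real.sin ((n + 1) * θ) * (2 * Real.cos θ ^ 2 - 1) +
          Real.cos ((n + 1) * θ) * Real.sin (2 * θ)) - l / (2 - l) * Real.sin ((n + 1) * θ)) =
        Real.sin ((n + 1) * θ) * ((2 - l) ^ 2)⁻¹ * (4 - κ ^ 2 * Real.cos θ ^ 2) := by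
      rw [hκ]
      field_simp
      ring
    rw [← mul_div_assoc, ← sub_div, div_eq_iff hG.ne', ← mul_assoc, ← sub_mul, hnum]
    ring
  simp_rw [this]
  rw [intervalIntegral.integral_mul_const, integral_sin_mul_sin]
  split_ifs <;> simp [div_eq_mul_inv]

lemma abs_kestenIntegral_le {l κ : ℝ} (hl0 : 0 < l) (hl1 : l < 1)
    (hκ : κ ^ 2 = 4 * (l * (2 - l))) (n : ℕ) :
    |kestenIntegral l κ n| ≤ 2 / (4 * (1 - l) ^ 2) * Real.pi := by
  have h := intervalIntegral.norm_integral_le_of_norm_le_const (a := 0) (b := Real.pi)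
    (C := 2 / (4 * (1 - l) ^ 2)) (f := fun θ : ℝ =>
      (Real.sin ((n + 1) * θ) - l / (2 - l) * Real.sin ((n - 1) * θ)) *
    Real.sin θ / (4 - κ ^ 2 * Real.cos θ ^ 2)) ?_
  · rwa [sub_zero, abs_of_pos Real.pi_pos, Real.norm_eq_abs] at h
  · intro θ _
    obtain ⟨hG, hG0⟩ := kesten_denom_pos hl1 hκ θ
    have h3 : 0 < 4 * (1 - l) ^ 2 := mul_pos (by norm_num) (pow_pos (by linarith) 2)
    rw [Real.norm_eq_abs, abs_div, abs_of_pos hG0, abs_mul]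
    have hr : |l / (2 - l)| ≤ 1 := by
      rw [abs_of_pos (div_pos hl0 (by linarith)), div_le_one (by linarith)]; linarith
    have hA : |Real.sin ((n + 1) * θ) - l / (2 - l) * Real.sin ((n - 1) * θ)| ≤ 2 := by
      refine (abs_sub _ _).trans ?_
      rw [abs_mul]
      have := mul_le_one₀ hr (abs_nonneg _) (Real.abs_sin_le_one ((n - 1) * θ))
      linarith [Real.abs_sin_le_one ((n + 1) * θ)]
    have hB := mul_le_mul hA (Real.abs_sin_le_one θ) (abs_nonneg _) (by norm_num)
    gcongr
    linarith

/-- For `n ≥ 1` the preceding relation reads `I n = r * I (n + 2)` with `0 ≤ r < 1`. Iterating it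
against a bound independent of `n` forces `I n = 0`. -/
lemma kestenIntegral_eq_zero {l κ : ℝ} (hl0 : 0 < l) (hl1 : l < 1)
    (hκ : κ ^ 2 = 4 * (l * (2 - l))) {n : ℕ} (hn : n ≠ 0) : kestenIntegral l κ n = 0 := by
  set r := l / (2 - l) with hr
  have hr0 : 0 ≤ r := (div_pos hl0 (by linarith)).le
  have hr1 : r < 1 := by rw [hr, div_lt_one (by linarith)]; linarith
  have hk (k : ℕ) : kestenIntegral l κ n = r ^ k * kestenIntegral l κ (n + 2 * k) := by
    induction k with
    | zero => simp
    | succ k ih =>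
      have := kestenIntegral_sub hl1 hκ (n + 2 * k)
      rw [if_neg (by omega)] at this
      rw [ih, pow_succ, mul_assoc, show n + 2 * (k + 1) = n + 2 * k + 2 by ring]
      congr 1
      linarith
  have hb (k : ℕ) : |kestenIntegral l κ n| ≤ r ^ k * (2 / (4 * (1 - l) ^ 2) * Real.pi) := by
    rw [hk k, abs_mul, abs_of_nonneg (pow_nonneg hr0 k)]
    gcongr
    exact abs_kestenIntegral_le hl0 hl1 hκ _
  have ht := (tendsto_pow_atTop_nhds_zero_of_lt_one hr0 hr1).mul_const
    (2 / (4 * (1 - l) ^ 2) * Real.pi)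
  rw [zero_mul] at ht
  exact abs_nonpos_iff.mp (ge_of_tendsto' ht hb)

lemma integral_kestenPoly {l κ : ℝ} (hl0 : 0 < l) (hl1 : l < 1)
    (hκ : κ ^ 2 = 4 * (l * (2 - l))) (n : ℕ) :
    ∫ θ in (0 : ℝ)..Real.pi, (kestenPoly l n).eval (2 + κ * Real.cos θ) * Real.sin θ ^ 2 /
      (4 - κ ^ 2 * Real.cos θ ^ 2) = if n = 0 then Real.pi / (4 * (2 - l)) else 0 := by
  have h2 : (2 - l) ≠ 0 := by linarith
  split_ifs with h
  · subst h
    have h0 := kestenIntegral_sub hl1 hκ 0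
    rw [kestenIntegral_eq_zero hl0 hl1 hκ (by norm_num : 0 + 2 ≠ 0), if_pos rfl, mul_zero,
      sub_zero, kestenIntegral] at h0
    -- Here the second sine is `sin (-θ)`, which yields the factor `1 + l / (2 - l) = 2 / (2 - l)`.
    have : ∀ θ : ℝ, (Real.sin (((0 : ℕ) + 1) * θ) - l / (2 - l) * Real.sin (((0 : ℕ) - 1) * θ)) *
      Real.sin θ / (4 - κ ^ 2 * Real.cos θ ^ 2) = (2 / (2 - l)) *
      ((kestenPoly l 0).eval (2 + κ * Real.cos θ) * Real.sin θ ^ 2 /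
        (4 - κ ^ 2 * Real.cos θ ^ 2)) := by
      intro θ
      have e : (((0 : ℕ) : ℝ) - 1) * θ = -θ := by push_cast; ring
      have hG := (kesten_denom_pos hl1 hκ θ).2.ne'
      rw [e, Real.sin_neg]
      simp only [kestenPoly, Polynomial.eval_one, Nat.cast_zero, zero_add, one_mul]
      field_simp
      ring
    simp_rw [this] at h0
    rw [intervalIntegral.integral_const_mul] at h0
    field_simp at h0 ⊢
    linarith
  · obtain ⟨m, rfl⟩ := Nat.exists_eq_succ_of_ne_zero h
    have : ∀ θ : ℝ, (kestenPoly l (m + 1)).eval (2 + κ * Real.cos θ) * Real.sin θ ^ 2 /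
      (4 - κ ^ 2 * Real.cos θ ^ 2) = (κ / 2) ^ (m + 1) *
      ((Real.sin (((m + 1 : ℕ) + 1) * θ) - l / (2 - l) * Real.sin (((m + 1 : ℕ) - 1) * θ)) *
      Real.sin θ / (4 - κ ^ 2 * Real.cos θ ^ 2)) := by
      intro θ
      have := kestenPoly_eval_mul_sin hl1 hκ θ m
      have e1 : (((m + 1 : ℕ) : ℝ) + 1) = m + 2 := by push_cast; ring
      have e2 : (((m + 1 : ℕ) : ℝ) - 1) = m := by push_cast; ring
      rw [e1, e2, sq, ← mul_assoc, this]
      ring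
    simp_rw [Nat.succ_eq_add_one, this]
    rw [intervalIntegral.integral_const_mul]
    have := kestenIntegral_eq_zero hl0 hl1 hκ h
    rw [kestenIntegral] at this
    rw [Nat.succ_eq_add_one] at this
    rw [this, mul_zero]

namespace RectProbSpace

variable {d : ℕ} {ρ : Fin d → ℝ} {A : Type*} [Ring A] [StarRing A] [Algebra ℂ A] [StarModule ℂ A]

/-! ### Null elements of a rectangular probability space -/

lemma φ_mul_p (S : RectProbSpace ρ A) (k : Fin d) (x : A) : S.φ k (x * S.p k) = S.φ k x := by
  rw [← S.φ_compress k (x * S.p k), ← S.φ_compress k x, mul_assoc (S.p k), mul_assoc x, S.p_idem,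
    mul_assoc]

lemma φ_p_mul (S : RectProbSpace ρ A) (k : Fin d) (x : A) : S.φ k (S.p k * x) = S.φ k x := by
  rw [← S.φ_compress k (S.p k * x), ← S.φ_compress k x, ← mul_assoc (S.p k), S.p_idem]

/-- Cauchy–Schwarz: an element of length zero of a corner is orthogonal to this corner. -/
lemma φ_star_mul_eq_zero (S : RectProbSpace ρ A) {k : Fin d} {h y : A}
    (hh : S.p k * h * S.p k = h) (hy : S.p k * y * S.p k = y) (h0 : S.φ k (star h * h) = 0) :
    S.φ k (star y * h) = 0 := by
  -- Positivity at `y + t • h`: the quadratic term in `t` is absent because `h` has length zero.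
  have key (t : ℂ) : 0 ≤ (S.φ k (star y * y)).re + (t * S.φ k (star y * h)).re +
      (star t * S.φ k (star h * y)).re ∧ (t * S.φ k (star y * h)).im +
      (star t * S.φ k (star h * y)).im = 0 := by
    have hc : S.p k * (y + t • h) * S.p k = y + t • h := by
      rw [mul_add, add_mul, mul_smul_comm, smul_mul_assoc, hy, hh]
    have e : S.φ k (star (y + t • h) * (y + t • h)) = S.φ k (star y * y) +
        t * S.φ k (star y * h) + star t * S.φ k (star h * y) := by
      simp only [star_add, star_smul, add_mul, mul_add, smul_mul_assoc, mul_smul_comm, map_add,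
        map_smul, h0, smul_eq_mul]
      ring
    have hp := S.φ_pos k _ hc
    have hpy := (S.φ_pos k y hy).2
    rw [e] at hp
    simp only [Complex.add_re, Complex.add_im] at hp
    rw [hpy] at hp
    exact ⟨hp.1, by linarith [hp.2]⟩
  set α := S.φ k (star y * h)
  set β := S.φ k (star h * y)
  set c := (S.φ k (star y * y)).re
  -- The reality conditions at `t = 1` and `t = I` say that `β` is the conjugate of `α`. The
  -- inequalities for real and imaginary `t` then bound affine functions of `r` from below, so their
  -- slopes must vanish.
  have h1 := (key 1).2
  have hI := (key Complex.I).2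
  have him : α.im = -β.im := by simp at h1; linarith
  have hre : α.re = β.re := by simp at hI; linarith
  have hr (r : ℝ) : 0 ≤ c + 2 * r * α.re := by
    have := (key r).1
    simp at this
    rw [← hre] at this; linarith
  have hi (r : ℝ) : 0 ≤ c - 2 * r * α.im := by
    have := (key (r * Complex.I)).1
    simp at this
    rw [him]; rw [him] at this; linarith
  have hre0 : α.re = 0 := by
    by_contra hne
    have := hr (-(c + 1) / (2 * α.re))
    have e : 2 * (-(c + 1) / (2 * α.re)) * α.re = -(c + 1) := by field_simp
    rw [e] at this; linarith
  have him0 : α.im = 0 := by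
    by_contra hne
    have := hi ((c + 1) / (2 * α.im))
    have e : 2 * ((c + 1) / (2 * α.im)) * α.im = c + 1 := by field_simp
    rw [e] at this; linarith
  exact Complex.ext hre0 him0

/-- Two elements are congruent if no state can distinguish them. -/
def nullCon (S : RectProbSpace ρ A) : RingCon A where
  r x y := ∀ k u v, S.φ k (u * x * v) = S.φ k (u * y * v)
  iseqv := ⟨fun _ _ _ _ => rfl, fun h k u v => (h k u v).symm,
    fun h h' k u v => (h k u v).trans (h' k u v)⟩
  add' {w x y z} h h' k u v := by
    simp only [mul_add, add_mul, map_add, h k u v, h' k u v]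
  mul' {w x y z} h h' k u v := by
    have e1 : u * (w * y) * v = u * w * (y * v) := by simp only [mul_assoc]
    have e2 : u * x * (y * v) = u * x * y * v := by simp only [mul_assoc]
    rw [e1, h k u (y * v), e2, h' k (u * x) v, mul_assoc u x]

lemma φ_eq_of_nullCon (S : RectProbSpace ρ A) {x y : A} (h : S.nullCon x y) (k : Fin d) :
    S.φ k x = S.φ k y := by
  simpa using h k 1 1

/-- A self-adjoint element of length zero of a corner is congruent to zero. -/
lemma nullCon_of_length_zero (S : RectProbSpace ρ A) (hρ : ∀ k, ρ k ≠ 0) {k : Fin d} {x y : A}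
    (hx : S.p k * (x - y) * S.p k = x - y) (hs : star (x - y) = x - y)
    (h0 : S.φ k ((x - y) * (x - y)) = 0) : S.nullCon x y := by
  intro m u v
  set h := x - y with hh
  have hkp : S.p k * h = h := by rw [← hx, ← mul_assoc, ← mul_assoc, S.p_idem]
  have hpk : h * S.p k = h := by rw [← hx, mul_assoc, S.p_idem]
  have hzero (z : A) (hz : S.p k * z * S.p k = z) : S.φ k (z * h) = 0 := by
    have hz' : S.p k * star z * S.p k = star z := by
      conv_rhs => rw [← hz]
      simp [S.p_selfAdjoint, mul_assoc]
    have := S.φ_star_mul_eq_zero hx hz' (by rwa [hs])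
    rwa [star_star] at this
  suffices H : S.φ m (u * h * v) = 0 by
    rw [hh, mul_sub, sub_mul, map_sub, sub_eq_zero] at H
    exact H
  -- Since `h` lies in the corner of `p k`, the exchange relation carries `φ m (u * h * v)` to a
  -- multiple of `φ k` of `h` times an element of that corner, where Cauchy–Schwarz applies.
  have e1 : S.p m * (S.p m * u * S.p k) * S.p k = S.p m * u * S.p k := by
    rw [← mul_assoc, ← mul_assoc, S.p_idem, mul_assoc, S.p_idem]
  have e2 : S.p k * (h * v * S.p m) * S.p m = h * v * S.p m := by
    rw [← mul_assoc, ← mul_assoc, hkp, mul_assoc, S.p_idem]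
  have hex := S.φ_exchange m k _ _ e1 e2
  have e3 : S.p m * u * S.p k * (h * v * S.p m) = S.p m * (u * h * v) * S.p m := by
    simp only [mul_assoc]
    rw [← mul_assoc (S.p k) h, hkp]
  have e4 : h * v * S.p m * (S.p m * u * S.p k) = h * (S.p k * (v * S.p m * u) * S.p k) := by
    simp only [mul_assoc]
    rw [← mul_assoc h (S.p k), hpk, ← mul_assoc (S.p m) (S.p m), S.p_idem]
  have e5 : S.p k * (S.p k * (v * S.p m * u) * S.p k) * S.p k =
      S.p k * (v * S.p m * u) * S.p k := by
    rw [← mul_assoc, ← mul_assoc, S.p_idem, mul_assoc, S.p_idem]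
  rw [e3, e4, S.φ_compress, S.φ_tracial k _ _ hx e5, hzero _ e5, mul_zero] at hex
  exact (mul_eq_zero.mp hex).resolve_left (by exact_mod_cast hρ m)

/-! ### Alternating words -/

/-- The span of the alternating words of centred elements whose first letter has index `j`. -/
def altSpan (S : RectProbSpace ρ A) {J : Type*} (B : J → StarSubalgebra ℂ A) (j : J) :
    Submodule ℂ A :=
  Submodule.span ℂ {x | ∃ w : List (J × A), w.IsChain (fun u v => u.1 ≠ v.1) ∧
    (∀ u ∈ w, u.2 ∈ B u.1 ∧ S.condExp u.2 = 0) ∧ (∃ u ∈ w.head?, u.1 = j) ∧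
    (w.map Prod.snd).prod = x}

lemma condExp_add (S : RectProbSpace ρ A) (x y : A) :
    S.condExp (x + y) = S.condExp x + S.condExp y := by
  simp [condExp, S.φ_compress, add_smul, Finset.sum_add_distrib]

lemma condExp_smul (S : RectProbSpace ρ A) (c : ℂ) (x : A) :
    S.condExp (c • x) = c • S.condExp x := by
  simp [condExp, S.φ_compress, Finset.smul_sum, mul_smul]

lemma condExp_eq_zero_iff (S : RectProbSpace ρ A) (x : A) :
    S.condExp x = 0 ↔ ∀ k, S.φ k x = 0 := by
  constructor
  · intro h k
    have h1 : S.p k * S.condExp x = S.φ k x • S.p k := by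
      rw [condExp, Finset.mul_sum, Finset.sum_eq_single k]
      · rw [mul_smul_comm, S.p_idem, S.φ_compress]
      · intro l _ hl
        rw [mul_smul_comm, S.p_orthogonal k l hl.symm, smul_zero]
      · simp
    rw [h, mul_zero] at h1
    exact (smul_eq_zero.mp h1.symm).resolve_right (S.p_ne_zero k)
  · intro h
    simp [condExp, S.φ_compress, h]

variable {J : Type*} {B : J → StarSubalgebra ℂ A}

lemma condExp_of_mem_altSpan (S : RectProbSpace ρ A) (hB : S.FreeSubalgebras B) {j : J} {x : A}
    (hx : x ∈ S.altSpan B j) : S.condExp x = 0 := by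
  induction hx using Submodule.span_induction with
  | mem x hx =>
    obtain ⟨w, h1, h2, ⟨u, hu, _⟩, rfl⟩ := hx
    refine hB.2 w ?_ h1 h2
    rintro rfl
    simp at hu
  | zero => simp [condExp]
  | add x y _ _ hx hy => rw [S.condExp_add, hx, hy, add_zero]
  | smul c x _ hx => rw [S.condExp_smul, hx, smul_zero]

lemma mem_altSpan (S : RectProbSpace ρ A) {j : J} {x : A} (hx : x ∈ B j)
    (h0 : S.condExp x = 0) : x ∈ S.altSpan B j :=
  Submodule.subset_span ⟨[(j, x)], by simp, by simp [hx, h0], ⟨(j, x), by simp⟩, by simp⟩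

/-- Recording the index of the first letter is what allows a centred letter of another index to be
put in front. -/
lemma mul_mem_altSpan (S : RectProbSpace ρ A) {i j : J} (hij : i ≠ j) {x y : A} (hx : x ∈ B i)
    (h0 : S.condExp x = 0) (hy : y ∈ S.altSpan B j) : x * y ∈ S.altSpan B i := by
  induction hy using Submodule.span_induction with
  | mem y hy =>
    obtain ⟨w, h1, h2, ⟨u, hu, huj⟩, rfl⟩ := hy
    refine Submodule.subset_span ⟨(i, x) :: w, ?_, ?_, ⟨(i, x), by simp⟩, by simp⟩
    · rw [List.isChain_cons]
      refine ⟨fun v hv => ?_, h1⟩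
      have : u = v := Option.mem_unique hu hv
      rw [← this, huj]
      exact hij
    · simp only [List.mem_cons, forall_eq_or_imp]
      exact ⟨⟨hx, h0⟩, h2⟩
  | zero => simp
  | add y z _ _ hy hz => rw [mul_add]; exact add_mem hy hz
  | smul c y _ hy => rw [mul_smul_comm]; exact Submodule.smul_mem _ _ hy

end RectProbSpace

/-! ### The recursion -/

section Recursion

variable {A : Type*} [Ring A] [Algebra ℂ A]

/-- Sums of reduced words in two coisometries `a`, `b` with adjoints `a'`, `b'`: the first
component is made of words starting with index `0`, the second one of words starting with
index `1`. -/
noncomputable def redSum (l : ℂ) (p a b a' b' : A) : ℕ → A × A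
  | 0 => (a', b')
  | n + 1 => (a' * (b * (redSum l p a b a' b' n).1) +
      (a' * a - l • p) * (redSum l p a b a' b' n).2,
      b' * (a * (redSum l p a b a' b' n).2) +
      (b' * b - l • p) * (redSum l p a b a' b' n).1)

/-- The sums of all reduced words of given length from the first corner to itself. -/
noncomputable def redWord (l : ℂ) (p a b a' b' : A) (n : ℕ) : A :=
  a * (redSum l p a b a' b' n).2 + b * (redSum l p a b a' b' n).1

lemma map_redSum {A' : Type*} [Ring A'] [Algebra ℂ A'] (f : A →ₐ[ℂ] A') (l : ℂ)
    (p a b a' b' : A) (n : ℕ) :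
    redSum l (f p) (f a) (f b) (f a') (f b') n =
      (f (redSum l p a b a' b' n).1, f (redSum l p a b a' b' n).2) := by
  induction n with
  | zero => rfl
  | succ n ih => simp [redSum, ih]

lemma map_redWord {A' : Type*} [Ring A'] [Algebra ℂ A'] (f : A →ₐ[ℂ] A') (l : ℂ)
    (p a b a' b' : A) (n : ℕ) :
    redWord l (f p) (f a) (f b) (f a') (f b') n = f (redWord l p a b a' b' n) := by
  simp [redWord, map_redSum]

/-- Equal neighbours `a * a'` collapse to `p₀` and give the term `2 • redWord n`. Unequal neighbours
continue the word, except that `a' * a` must be centred by subtracting `l • p`. That correction is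
`l • (a * U + b * V)`, whose letters collapse once more: to `(2 - l)` times the previous sum, or to
`2 • p₀` when `n = 0`. -/
lemma sum_mul_redWord {l : ℂ} {p₀ p a b a' b' : A} (haa : a * a' = p₀) (hbb : b * b' = p₀)
    (ha : p₀ * a = a) (hb : p₀ * b = b)
    (hap' : p * a' = a') (hbp' : p * b' = b') (hpp : p * p = p) (n : ℕ) :
    (a + b) * (a' + b') * redWord l p a b a' b' n = redWord l p a b a' b' (n + 1) +
      (2 : ℂ) • redWord l p a b a' b' n +
      (match n with
        | 0 => (2 * l) • p₀
        | n + 1 => (l * (2 - l)) • redWord l p a b a' b' n) := by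
  have hU (n : ℕ) : p * (redSum l p a b a' b' n).1 = (redSum l p a b a' b' n).1 := by
    cases n with
    | zero => exact hap'
    | succ n => simp only [redSum, mul_add, mul_sub, ← mul_assoc, mul_smul_comm, hap', hpp]
  have hV (n : ℕ) : p * (redSum l p a b a' b' n).2 = (redSum l p a b a' b' n).2 := by
    cases n with
    | zero => exact hbp'
    | succ n => simp only [redSum, mul_add, mul_sub, ← mul_assoc, mul_smul_comm, hbp', hpp]
  have main : (a + b) * (a' + b') * redWord l p a b a' b' n = redWord l p a b a' b' (n + 1) +
      (2 : ℂ) • redWord l p a b a' b' n +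
      l • (a * (redSum l p a b a' b' n).1 + b * (redSum l p a b a' b' n).2) := by
    have hU := hU n
    have hV := hV n
    simp only [redWord, redSum]
    generalize (redSum l p a b a' b' n).1 = U at *
    generalize (redSum l p a b a' b' n).2 = V at *
    have e1 : a * a' * (a * V) = a * V := by rw [haa, ← mul_assoc, ha]
    have e2 : a * a' * (b * U) = b * U := by rw [haa, ← mul_assoc, hb]
    have e3 : b * b' * (a * V) = a * V := by rw [hbb, ← mul_assoc, ha]
    have e4 : b * b' * (b * U) = b * U := by rw [hbb, ← mul_assoc, hb]
    have f1 : (a + b) * (a' + b') * (a * V + b * U) = a * a' * (a * V) + a * a' * (b * U) +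
        b * b' * (a * V) + b * b' * (b * U) + (a * (b' * (a * V)) + a * (b' * (b * U)) +
        b * (a' * (a * V)) + b * (a' * (b * U))) := by noncomm_ring
    have f2 : a * (b' * (a * V) + (b' * b - l • p) * U) + b * (a' * (b * U) +
        (a' * a - l • p) * V) = (a * (b' * (a * V)) + a * (b' * (b * U)) +
        b * (a' * (a * V)) + b * (a' * (b * U))) - l • (a * U + b * V) := by
      simp only [mul_add, sub_mul, mul_sub, smul_mul_assoc, mul_smul_comm, hU, hV, mul_assoc,
        smul_add]
      abel
    rw [f1, f2, e1, e2, e3, e4, two_smul]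
    abel
  rw [main]
  congr 1
  cases n with
  | zero => simp only [redSum, haa, hbb, ← two_smul ℂ p₀, smul_smul, mul_comm]
  | succ n =>
    simp only [redWord, redSum]
    have hU := hU n
    have hV := hV n
    generalize (redSum l p a b a' b' n).1 = U at *
    generalize (redSum l p a b a' b' n).2 = V at *
    have e1 : a * (a' * (b * U)) = b * U := by rw [← mul_assoc, haa, ← mul_assoc, hb]
    have e2 : b * (b' * (a * V)) = a * V := by rw [← mul_assoc, hbb, ← mul_assoc, ha]
    have e3 : a * (a' * (a * V)) = a * V := by rw [← mul_assoc, haa, ← mul_assoc, ha]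
    have e4 : b * (b' * (b * U)) = b * U := by rw [← mul_assoc, hbb, ← mul_assoc, hb]
    simp only [mul_add, sub_mul, mul_sub, smul_mul_assoc, mul_smul_comm, hU, hV, mul_assoc,
      e1, e2, e3, e4]
    module

/-- In the presence of two coisometries, the Kesten polynomials are sums of reduced words. -/
lemma aeval_kestenPoly_mul {l : ℝ} {p₀ p a b a' b' : A} (haa : a * a' = p₀) (hbb : b * b' = p₀)
    (ha : p₀ * a = a) (hb : p₀ * b = b)
    (hap' : p * a' = a') (hbp' : p * b' = b') (hpp : p * p = p) (ha' : a' * p₀ = a')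
    (hb' : b' * p₀ = b') (n : ℕ) :
    Polynomial.aeval ((a + b) * (a' + b')) (kestenPoly l (n + 1)) * p₀ =
      redWord (l : ℂ) p a b a' b' n := by
  have hrec := sum_mul_redWord (l := (l : ℂ)) haa hbb ha hb hap' hbp' hpp
  have hsm (r : ℝ) (x : A) : algebraMap ℝ A r * x = (r : ℂ) • x := by
    rw [← Algebra.smul_def, Complex.coe_smul]
  have h0 : ((a + b) * (a' + b') - algebraMap ℝ A 2) * p₀ = redWord (l : ℂ) p a b a' b' 0 := by
    rw [sub_mul, hsm, mul_assoc, add_mul a', ha', hb']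
    simp only [redWord, redSum, add_mul, mul_add, haa, hbb, Complex.ofReal_ofNat, two_smul]
    abel
  have hmul (x : A) : ((a + b) * (a' + b') - algebraMap ℝ A 2) * x =
      (a + b) * (a' + b') * x - (2 : ℂ) • x := by
    rw [sub_mul, hsm]; simp
  induction n using Nat.twoStepInduction with
  | zero =>
    simpa only [kestenPoly, map_sub, Polynomial.aeval_X, Polynomial.aeval_C] using h0
  | one =>
    simp only [kestenPoly, map_sub, map_pow, Polynomial.aeval_X, Polynomial.aeval_C]
    rw [sub_mul, sq, mul_assoc, h0, hmul, hrec 0, hsm]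
    push_cast
    abel
  | more n ih0 ih1 =>
    have e : kestenPoly l (n + 2 + 1) = (Polynomial.X - Polynomial.C 2) * kestenPoly l (n + 1 + 1)
        - Polynomial.C (l * (2 - l)) * kestenPoly l (n + 1) := by rw [kestenPoly]
    rw [e]
    simp only [map_sub, map_mul, Polynomial.aeval_X, Polynomial.aeval_C] at ih0 ih1 ⊢
    rw [← map_sub, ← map_mul, sub_mul, mul_assoc, mul_assoc, ih0, ih1, hmul, hsm, hrec (n + 1)]
    push_cast
    abel

end Recursion

namespace RectProbSpace

variable {A : Type*} [Ring A] [StarRing A] [Algebra ℂ A] [StarModule ℂ A] {lam : ℝ}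

/-- The values of the Kesten polynomials under any realization of the convolution. -/
lemma φ_kestenPoly (hlam₀ : 0 < lam) (S : RectProbSpace ![lam / (1 + lam), 1 / (1 + lam)] A)
    {a : Fin 2 → A} (hcorner : ∀ i, S.p 0 * a i * S.p 1 = a i) (hfree : S.FreeSets (fun i => {a i}))
    (h1 : ∀ i, S.φ 0 (a i * star (a i)) = 1) (h2 : ∀ i, S.φ 0 ((a i * star (a i)) ^ 2) = 1)
    (n : ℕ) :
    S.φ 0 (Polynomial.aeval ((a 0 + a 1) * star (a 0 + a 1)) (kestenPoly lam n)) =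
      if n = 0 then 1 else 0 := by
  have hρ : ∀ k, ![lam / (1 + lam), 1 / (1 + lam)] k ≠ 0 := by
    intro k
    have h : (1 + lam) ≠ 0 := by positivity
    fin_cases k <;> simp [h, hlam₀.ne']
  have hpa (i) : S.p 0 * a i = a i := by
    rw [← hcorner i, ← mul_assoc, ← mul_assoc, S.p_idem]
  have hap (i) : a i * S.p 1 = a i := by rw [← hcorner i, mul_assoc, S.p_idem]
  have hpa' (i) : S.p 1 * star (a i) = star (a i) := by
    conv_rhs => rw [← hap i]
    rw [star_mul, S.p_selfAdjoint]
  have hap' (i) : star (a i) * S.p 0 = star (a i) := by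
    conv_rhs => rw [← hpa i]
    rw [star_mul, S.p_selfAdjoint]
  have hnull (i) : S.nullCon (a i * star (a i)) (S.p 0) := by
    refine S.nullCon_of_length_zero hρ (k := 0) ?_ ?_ ?_
    · rw [mul_sub, sub_mul, ← mul_assoc, hpa, mul_assoc, hap', S.p_idem, S.p_idem]
    · rw [star_sub, star_mul, star_star, S.p_selfAdjoint]
    -- The state of this square is `1 - 1 - 1 + 1 = 0`, so only the first two moments are used.
    · have e : (a i * star (a i) - S.p 0) * (a i * star (a i) - S.p 0) =
          (a i * star (a i)) ^ 2 - a i * star (a i) - a i * star (a i) + S.p 0 := by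
        rw [sub_mul, mul_sub, mul_sub, S.p_idem, mul_assoc (a i) _ (S.p 0), hap', ← mul_assoc
          (S.p 0), hpa, sq]
        abel
      rw [e, map_add, map_sub, map_sub, h1, h2, S.φ_unital]
      norm_num
  rcases n with _ | n
  · rw [kestenPoly, map_one, if_pos rfl, ← S.φ_mul_p, one_mul, S.φ_unital]
  rw [if_neg (Nat.succ_ne_zero n), ← S.φ_mul_p]
  -- The coisometry relation holds exactly only in the quotient. The polynomial identity is proved
  -- there and pulled back through `φ 0`, which factors through the quotient; freeness is used in
  -- `A` itself.
  set c := S.nullCon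
  let π := c.mkₐ ℂ
  have hπ (x y : A) (h : π x = π y) : S.φ 0 x = S.φ 0 y :=
    S.φ_eq_of_nullCon (c.eq.mp h) 0
  have hq (i) : π (a i) * π (star (a i)) = π (S.p 0) := by
    rw [← map_mul]; exact c.eq.mpr (hnull i)
  have hev (x : A) (P : Polynomial ℝ) :
      π (Polynomial.aeval x P) = Polynomial.aeval (π x) P :=
    (Polynomial.aeval_algHom_apply (π.restrictScalars ℝ) x P).symm
  have hkey : π (Polynomial.aeval ((a 0 + a 1) * star (a 0 + a 1)) (kestenPoly lam (n + 1)) *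
      S.p 0) = π (redWord (lam : ℂ) (S.p 1) (a 0) (a 1) (star (a 0)) (star (a 1)) n) := by
    rw [map_mul, hev, ← map_redWord, star_add, map_mul, map_add, map_add]
    refine aeval_kestenPoly_mul (hq 0) (hq 1) ?_ ?_ ?_ ?_ ?_ ?_ ?_ n <;>
      rw [← map_mul] <;> simp [hpa, hpa', hap', S.p_idem]
  rw [hπ _ _ hkey]
  obtain ⟨B, hB, haB⟩ := hfree
  have ha (i) : a i ∈ B i := haB i (Set.mem_singleton _)
  have ha' (i) : star (a i) ∈ B i := star_mem (ha i)
  have hp1 (i) : S.p 1 ∈ B i := hB.1 i (Submodule.subset_span ⟨1, rfl⟩)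
  have h01 : S.p 0 * S.p 1 = 0 := S.p_orthogonal 0 1 (by decide)
  have h10 : S.p 1 * S.p 0 = 0 := S.p_orthogonal 1 0 (by decide)
  have hEa (i) : S.condExp (a i) = 0 := by
    refine (S.condExp_eq_zero_iff _).mpr fun k => ?_
    fin_cases k
    · change S.φ 0 (a i) = 0
      rw [← S.φ_mul_p, ← hap i, mul_assoc, h10, mul_zero, map_zero]
    · change S.φ 1 (a i) = 0
      rw [← S.φ_p_mul, ← hpa i, ← mul_assoc, h10, zero_mul, map_zero]
  have hEa' (i) : S.condExp (star (a i)) = 0 := by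
    refine (S.condExp_eq_zero_iff _).mpr fun k => ?_
    fin_cases k
    · change S.φ 0 (star (a i)) = 0
      rw [← S.φ_p_mul, ← hpa' i, ← mul_assoc, h01, zero_mul, map_zero]
    · change S.φ 1 (star (a i)) = 0
      rw [← S.φ_mul_p, ← hap' i, mul_assoc, h01, mul_zero, map_zero]
  have hEc (i) : S.condExp (star (a i) * a i - (lam : ℂ) • S.p 1) = 0 := by
    refine (S.condExp_eq_zero_iff _).mpr fun k => ?_
    fin_cases k
    · change S.φ 0 _ = 0
      rw [← S.φ_p_mul, mul_sub, ← hpa' i, mul_assoc, ← mul_assoc (S.p 0), h01, mul_smul_comm, h01]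
      simp
    · change S.φ 1 _ = 0
      -- The ratio of the two weights is `lam`, so `φ 1 (star (a i) * a i) = lam`: this is the
      -- centring constant in `redSum`.
      have hex := S.φ_exchange 0 1 (a i) (star (a i)) (hcorner i) (by rw [hpa', hap'])
      rw [h1] at hex
      rw [map_sub, map_smul, S.φ_unital, smul_eq_mul, mul_one, sub_eq_zero]
      have hne : (1 + lam : ℂ) ≠ 0 := by exact_mod_cast (by positivity : (1 + lam) ≠ 0)
      simp only [Matrix.cons_val_zero, Matrix.cons_val_one] at hex
      push_cast at hex
      field_simp at hex
      exact hex.symm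
  have hc (i) : star (a i) * a i - (lam : ℂ) • S.p 1 ∈ B i :=
    sub_mem (mul_mem (ha' i) (ha i)) ((B i).smul_mem (hp1 i) _)
  have hmem (n : ℕ) :
      (redSum (lam : ℂ) (S.p 1) (a 0) (a 1) (star (a 0)) (star (a 1)) n).1 ∈ S.altSpan B 0 ∧
      (redSum (lam : ℂ) (S.p 1) (a 0) (a 1) (star (a 0)) (star (a 1)) n).2 ∈ S.altSpan B 1 := by
    induction n with
    | zero => exact ⟨S.mem_altSpan (ha' 0) (hEa' 0), S.mem_altSpan (ha' 1) (hEa' 1)⟩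
    | succ n ih =>
      have n01 : (0 : Fin 2) ≠ 1 := by decide
      exact ⟨add_mem (S.mul_mem_altSpan n01 (ha' 0) (hEa' 0)
          (S.mul_mem_altSpan n01.symm (ha 1) (hEa 1) ih.1))
          (S.mul_mem_altSpan n01 (hc 0) (hEc 0) ih.2),
        add_mem (S.mul_mem_altSpan n01.symm (ha' 1) (hEa' 1)
          (S.mul_mem_altSpan n01 (ha 0) (hEa 0) ih.2))
          (S.mul_mem_altSpan n01.symm (hc 1) (hEc 1) ih.1)⟩
  have hz (j) (x : A) (hx : x ∈ S.altSpan B j) : S.φ 0 x = 0 :=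
    (S.condExp_eq_zero_iff x).mp (S.condExp_of_mem_altSpan hB hx) 0
  rw [redWord, map_add, hz 0 _ (S.mul_mem_altSpan (by decide) (ha 0) (hEa 0) (hmem n).2),
    hz 1 _ (S.mul_mem_altSpan (by decide) (ha 1) (hEa 1) (hmem n).1), add_zero]

end RectProbSpace

/-! ### Compactly supported measures and their moments -/

lemma integrable_of_compact_support {μ : Measure ℝ} [IsFiniteMeasure μ] (hμ : IsCompact μ.support)
    {f : ℝ → ℝ} (hf : Continuous f) : Integrable f μ := by
  have h : μ.restrict μ.support = μ := Measure.restrict_eq_self_of_ae_mem Measure.support_mem_ae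
  rw [← h]
  exact hf.continuousOn.integrableOn_compact hμ

/-- The linear functional `P ↦ ∫ P(x²) dμ` of a compactly supported measure. -/
noncomputable def evenMoments (μ : Measure ℝ) [IsFiniteMeasure μ] (hμ : IsCompact μ.support) :
    Polynomial ℝ →ₗ[ℝ] ℝ where
  toFun P := ∫ x, P.eval (x ^ 2) ∂μ
  map_add' P Q := by
    simp only [Polynomial.eval_add]
    exact integral_add (integrable_of_compact_support hμ (by fun_prop))
      (integrable_of_compact_support hμ (by fun_prop))
  map_smul' c P := by
    simp only [Polynomial.eval_smul, smul_eq_mul, RingHom.id_apply]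
    exact integral_const_mul _ _

lemma abs_integral_sub_le_of_compact_support {μ : Measure ℝ} [IsProbabilityMeasure μ]
    (hμ : IsCompact μ.support) {s : Set ℝ} (hs : μ.support ⊆ s) {f g : ℝ → ℝ} (hf : Continuous f)
    (hg : Continuous g) {ε : ℝ} (h : ∀ x ∈ s, |f x - g x| ≤ ε) :
    |∫ x, f x ∂μ - ∫ x, g x ∂μ| ≤ ε := by
  rw [← integral_sub (integrable_of_compact_support hμ hf) (integrable_of_compact_support hμ hg)]
  have := norm_integral_le_of_norm_le_const (μ := μ) (f := fun x => f x - g x) (C := ε) ?_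
  · simpa using this
  · filter_upwards [Measure.support_mem_ae (μ := μ)] with x hx
    exact h x (hs hx)

/-- Compactly supported probability measures are determined by their moments. -/
lemma eq_of_moments_eq {μ ν : Measure ℝ} [IsProbabilityMeasure μ] [IsProbabilityMeasure ν]
    (hμ : IsCompact μ.support) (hν : IsCompact ν.support)
    (h : ∀ n : ℕ, ∫ x, x ^ n ∂μ = ∫ x, x ^ n ∂ν) : μ = ν := by
  have hP (P : Polynomial ℝ) : ∫ x, P.eval x ∂μ = ∫ x, P.eval x ∂ν := by
    induction P using Polynomial.induction_on' with
    | add P Q hP hQ =>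
      simp only [Polynomial.eval_add]
      rw [integral_add (integrable_of_compact_support hμ (by fun_prop))
        (integrable_of_compact_support hμ (by fun_prop)),
        integral_add (integrable_of_compact_support hν (by fun_prop))
        (integrable_of_compact_support hν (by fun_prop)), hP, hQ]
    | monomial n c =>
      simp only [Polynomial.eval_monomial]
      rw [integral_const_mul, integral_const_mul, h]
  obtain ⟨R, hR⟩ := (hμ.union hν).isBounded.subset_closedBall 0
  rw [Real.closedBall_eq_Icc] at hR
  obtain ⟨hRμ, hRν⟩ := Set.union_subset_iff.mp hR
  refine ext_of_forall_integral_eq_of_IsFiniteMeasure fun f => ?_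
  refine eq_of_abs_sub_nonpos (le_of_forall_pos_le_add fun ε hε => ?_)
  -- Weierstrass approximation on an interval containing both supports; each measure contributes an
  -- error of `ε / 2`.
  obtain ⟨P, hPf⟩ := exists_polynomial_near_of_continuousOn (0 - R) (0 + R) f
    f.continuous.continuousOn (ε / 2) (half_pos hε)
  have hb (x : ℝ) (hx : x ∈ Set.Icc (0 - R) (0 + R)) : |P.eval x - f x| ≤ ε / 2 := (hPf x hx).le
  have h1 := abs_integral_sub_le_of_compact_support hμ hRμ P.continuous f.continuous hb
  have h2 := abs_integral_sub_le_of_compact_support hν hRν P.continuous f.continuous hb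
  rw [hP] at h1
  rw [abs_le] at h1 h2 ⊢
  constructor <;> linarith [h1.1, h1.2, h2.1, h2.2]

lemma integral_odd_pow_of_symm {μ : Measure ℝ} (hμ : μ.map (fun x => -x) = μ) {n : ℕ}
    (hn : Odd n) : ∫ x, x ^ n ∂μ = 0 := by
  have h : ∫ x, x ^ n ∂μ = ∫ x, (-x) ^ n ∂μ := by
    conv_lhs => rw [← hμ]
    exact integral_map (by fun_prop) (by fun_prop)
  simp only [hn.neg_pow, integral_neg] at h
  linarith

lemma IsSymmCompactProb.eq_of_even_moments {μ ν : Measure ℝ} (hμ : IsSymmCompactProb μ)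
    (hν : IsSymmCompactProb ν) (h : ∀ r : ℕ, ∫ x, x ^ (2 * r) ∂μ = ∫ x, x ^ (2 * r) ∂ν) :
    μ = ν := by
  have := hμ.prob
  have := hν.prob
  refine eq_of_moments_eq hμ.compact hν.compact fun n => ?_
  obtain ⟨r, rfl | rfl⟩ := Nat.even_or_odd' n
  · exact h r
  · rw [integral_odd_pow_of_symm hμ.symm ⟨r, rfl⟩, integral_odd_pow_of_symm hν.symm ⟨r, rfl⟩]

/-! ### The symmetric Bernoulli distribution -/

lemma integral_symmBernoulli (f : ℝ → ℝ) :
    ∫ x, f x ∂symmBernoulli = (f (-1) + f 1) / 2 := by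
  rw [symmBernoulli, integral_smul_measure, integral_add_measure
    (integrable_dirac (by simp)) (integrable_dirac (by simp)), integral_dirac, integral_dirac]
  simp
  ring

lemma isSymmCompactProb_symmBernoulli : IsSymmCompactProb symmBernoulli where
  prob := by
    constructor
    simp only [symmBernoulli, Measure.smul_apply, Measure.add_apply, measure_univ, smul_eq_mul]
    rw [one_add_one_eq_two, ENNReal.inv_mul_cancel (by norm_num) (by norm_num)]
  symm := by
    rw [symmBernoulli, Measure.map_smul, Measure.map_add _ _ (by fun_prop),
      Measure.map_dirac' (by fun_prop), Measure.map_dirac' (by fun_prop), neg_neg, add_comm]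
  compact := by
    have hc : IsCompact ({-1, 1} : Set ℝ) := (Set.toFinite _).isCompact
    refine hc.of_isClosed_subset Measure.isClosed_support
      (Measure.support_subset_of_isClosed hc.isClosed ?_)
    rw [mem_ae_iff, symmBernoulli]
    simp [Measure.dirac_apply' _ hc.isClosed.measurableSet.compl]

/-! ### The convolution -/

/-- The density of the convolution of two symmetric Bernoulli distributions. -/
noncomputable def kestenDensity (l κ : ℝ) (x : ℝ) : ℝ :=
  √(κ ^ 2 - (x ^ 2 - 2) ^ 2) / (Real.pi * l * |x| * (4 - x ^ 2))

/-- The support of the convolution of two symmetric Bernoulli distributions. -/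
def kestenSupport (κ : ℝ) : Set ℝ :=
  Set.Icc (-√(2 + κ)) (-√(2 - κ)) ∪ Set.Icc (√(2 - κ)) (√(2 + κ))

/-- The convolution of two symmetric Bernoulli distributions. -/
noncomputable def kestenMeasure (l κ : ℝ) : Measure ℝ :=
  (volume.restrict (kestenSupport κ)).withDensity fun x => ENNReal.ofReal (kestenDensity l κ x)

section Kesten

variable {l κ : ℝ}

lemma isCompact_kestenSupport (κ : ℝ) : IsCompact (kestenSupport κ) :=
  isCompact_Icc.union isCompact_Icc

lemma neg_mem_kestenSupport {x : ℝ} : -x ∈ kestenSupport κ ↔ x ∈ kestenSupport κ := by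
  simp only [kestenSupport, Set.mem_union, Set.mem_Icc, neg_le_neg_iff]
  constructor <;> rintro (h | h) <;> [right; left; right; left] <;> constructor <;>
    linarith [h.1, h.2]

lemma sq_mem_of_mem_Icc (hκ : κ ∈ Set.Ioo (0 : ℝ) 2) {x : ℝ}
    (hx : x ∈ Set.Icc (√(2 - κ)) (√(2 + κ))) : 0 < x ∧ x ^ 2 - 2 ∈ Set.Icc (-κ) κ := by
  have h0 : 0 < √(2 - κ) := Real.sqrt_pos.mpr (by linarith [hκ.2])
  have hx0 := h0.trans_le hx.1
  have h1 : 2 - κ ≤ x ^ 2 := (Real.sqrt_le_left hx0.le).mp hx.1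
  have h2 : x ^ 2 ≤ 2 + κ := (Real.le_sqrt' hx0).mp hx.2
  exact ⟨hx0, by linarith, by linarith⟩

lemma sq_mem_of_mem_kestenSupport (hκ : κ ∈ Set.Ioo (0 : ℝ) 2) {x : ℝ}
    (hx : x ∈ kestenSupport κ) : x ≠ 0 ∧ x ^ 2 - 2 ∈ Set.Icc (-κ) κ := by
  wlog h : x ∈ Set.Icc (√(2 - κ)) (√(2 + κ)) generalizing x
  · have hx' : x ∈ Set.Icc (-√(2 + κ)) (-√(2 - κ)) := hx.resolve_right h
    have := this (neg_mem_kestenSupport.mpr hx) ⟨by linarith [hx'.2], by linarith [hx'.1]⟩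
    simpa using this
  · exact ⟨(sq_mem_of_mem_Icc hκ h).1.ne', (sq_mem_of_mem_Icc hκ h).2⟩

lemma kestenDensity_nonneg (hl : 0 < l) (hκ : κ ∈ Set.Ioo (0 : ℝ) 2) {x : ℝ}
    (hx : x ∈ kestenSupport κ) : 0 ≤ kestenDensity l κ x := by
  have h := (sq_mem_of_mem_kestenSupport hκ hx).2
  have : 0 ≤ 4 - x ^ 2 := by linarith [h.2, hκ.2]
  have := Real.pi_pos
  unfold kestenDensity
  positivity

lemma continuousOn_kestenDensity (hl : 0 < l) (hκ : κ ∈ Set.Ioo (0 : ℝ) 2) :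
    ContinuousOn (kestenDensity l κ) (kestenSupport κ) := by
  refine ContinuousOn.div (by fun_prop) (by fun_prop) fun x hx => ?_
  obtain ⟨h0, h⟩ := sq_mem_of_mem_kestenSupport hκ hx
  have h1 : 0 < 4 - x ^ 2 := by linarith [h.2, hκ.2]
  have := Real.pi_pos
  positivity

lemma kestenDensity_neg (l κ x : ℝ) : kestenDensity l κ (-x) = kestenDensity l κ x := by
  simp [kestenDensity]

lemma measurable_kestenDensity (l κ : ℝ) : Measurable (kestenDensity l κ) := by
  unfold kestenDensity
  fun_prop

lemma integral_kestenMeasure (hl : 0 < l) (hκ : κ ∈ Set.Ioo (0 : ℝ) 2) (h : ℝ → ℝ) :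
    ∫ x, h x ∂kestenMeasure l κ = ∫ x in kestenSupport κ, kestenDensity l κ x * h x := by
  rw [kestenMeasure, integral_withDensity_eq_integral_toReal_smul
    (measurable_kestenDensity l κ).ennreal_ofReal (by simp)]
  refine setIntegral_congr_fun (isCompact_kestenSupport κ).measurableSet fun x hx => ?_
  simp only [smul_eq_mul]
  rw [ENNReal.toReal_ofReal (kestenDensity_nonneg hl hκ hx)]

/-- By evenness the integral is twice that over the positive interval. The substitutions `y = x ^ 2
- 2` and `y = κ * cos θ` then turn the square root into `κ * sin θ`. -/
lemma integral_kestenMeasure_comp_sq (hl : 0 < l) (hκ : κ ∈ Set.Ioo (0 : ℝ) 2) {h : ℝ → ℝ}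
    (hh : Continuous h) :
    ∫ x, h (x ^ 2) ∂kestenMeasure l κ = κ ^ 2 / (Real.pi * l) *
      ∫ θ in (0 : ℝ)..Real.pi, h (2 + κ * Real.cos θ) * Real.sin θ ^ 2 /
        (4 - κ ^ 2 * Real.cos θ ^ 2) := by
  obtain ⟨hκ0, hκ2⟩ := hκ
  have hπ := Real.pi_pos
  set a := √(2 - κ) with ha
  set b := √(2 + κ) with hb
  have ha0 : 0 < a := Real.sqrt_pos.mpr (by linarith)
  have hab : a ≤ b := Real.sqrt_le_sqrt (by linarith)
  set F : ℝ → ℝ := fun x => kestenDensity l κ x * h (x ^ 2) with hF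
  have hFc : ContinuousOn F (kestenSupport κ) :=
    (continuousOn_kestenDensity hl ⟨hκ0, hκ2⟩).mul (by fun_prop)
  have hdisj : Disjoint (Set.Icc (-b) (-a)) (Set.Icc a b) := by
    rw [Set.disjoint_left]
    intro x hx hx'
    linarith [hx.2, hx'.1]
  have hneg : ∫ x in Set.Icc (-b) (-a), F x = ∫ x in Set.Icc a b, F x := by
    rw [integral_Icc_eq_integral_Ioc, integral_Icc_eq_integral_Ioc,
      ← intervalIntegral.integral_of_le (by linarith), ← intervalIntegral.integral_of_le hab,
      ← intervalIntegral.integral_comp_neg]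
    simp [hF, kestenDensity_neg]
  set G : ℝ → ℝ := fun y => h (2 + y) * √(κ ^ 2 - y ^ 2) / (Real.pi * l * (4 - y ^ 2)) with hG
  have hGc : ContinuousOn G (Set.Icc (-κ) κ) := by
    refine ContinuousOn.div (by fun_prop) (by fun_prop) fun y hy => ?_
    have : y ^ 2 ≤ κ ^ 2 := sq_le_sq' hy.1 hy.2
    have : 0 < 4 - y ^ 2 := by nlinarith
    positivity
  have h1 : 2 * ∫ x in a..b, F x = ∫ x in a..b, (G ∘ fun x => x ^ 2 - 2) x * (2 * x) := by
    rw [← intervalIntegral.integral_const_mul]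
    refine intervalIntegral.integral_congr fun x hx => ?_
    rw [Set.uIcc_of_le hab] at hx
    obtain ⟨hx0, hx1⟩ := sq_mem_of_mem_Icc ⟨hκ0, hκ2⟩ hx
    have hp : 4 - x ^ 2 ≠ 0 := by linarith [hx1.2]
    -- One factor `x` cancels against the Jacobian `2 * x`, the other is the `|x|` of the density.
    have e1 : 4 - (x ^ 2 - 2) ^ 2 = x ^ 2 * (4 - x ^ 2) := by ring
    simp only [hF, hG, kestenDensity, Function.comp_apply]
    rw [e1, abs_of_pos hx0, add_sub_cancel]
    field_simp
  have h2 : ∫ x in a..b, (G ∘ fun x => x ^ 2 - 2) x * (2 * x) = ∫ y in (-κ)..κ, G y := by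
    have ea : a ^ 2 - 2 = -κ := by rw [ha, Real.sq_sqrt (by linarith)]; ring
    have eb : b ^ 2 - 2 = κ := by rw [hb, Real.sq_sqrt (by linarith)]; ring
    rw [intervalIntegral.integral_comp_mul_deriv' (f := fun x => x ^ 2 - 2) (f' := fun x => 2 * x)]
    · simp only [ea, eb]
    · intro x _
      have := (hasDerivAt_pow 2 x).sub_const 2
      simpa using this
    · fun_prop
    · refine hGc.mono ?_
      rintro _ ⟨x, hx, rfl⟩
      rw [Set.uIcc_of_le hab] at hx
      exact (sq_mem_of_mem_Icc ⟨hκ0, hκ2⟩ hx).2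
  have h3 : ∫ y in (-κ)..κ, G y =
      ∫ θ in (0 : ℝ)..Real.pi, (G ∘ fun θ => κ * Real.cos θ) θ * (κ * Real.sin θ) := by
    have := intervalIntegral.integral_comp_mul_deriv' (f := fun θ => κ * Real.cos θ)
      (f' := fun θ => κ * -Real.sin θ) (g := G) (a := 0) (b := Real.pi)
      (fun θ _ => (Real.hasDerivAt_cos θ).const_mul κ) (by fun_prop) (hGc.mono ?_)
    · simp only [mul_neg, intervalIntegral.integral_neg, Real.cos_zero, Real.cos_pi, mul_one]
        at this
      rw [intervalIntegral.integral_symm, ← this, neg_neg]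
    · rintro _ ⟨θ, -, rfl⟩
      have h1 := Real.neg_one_le_cos θ
      have h2 := Real.cos_le_one θ
      constructor <;> dsimp only <;> nlinarith
  rw [integral_kestenMeasure hl ⟨hκ0, hκ2⟩, kestenSupport,
    setIntegral_union hdisj measurableSet_Icc
      ((hFc.mono Set.subset_union_left).integrableOn_compact isCompact_Icc)
      ((hFc.mono Set.subset_union_right).integrableOn_compact isCompact_Icc)]
  rw [hneg, ← two_mul, integral_Icc_eq_integral_Ioc, ← intervalIntegral.integral_of_le hab, h1, h2,
    h3, ← intervalIntegral.integral_const_mul]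
  refine intervalIntegral.integral_congr fun θ hθ => ?_
  rw [Set.uIcc_of_le hπ.le] at hθ
  have hs : √(κ ^ 2 - (κ * Real.cos θ) ^ 2) = κ * Real.sin θ := by
    rw [← Real.sqrt_sq (mul_nonneg hκ0.le (Real.sin_nonneg_of_mem_Icc hθ))]
    congr 1
    rw [mul_pow, mul_pow, Real.sin_sq]; ring
  simp only [hG, Function.comp_apply]
  rw [hs, mul_pow]
  have hc := Real.cos_sq_le_one θ
  have : 0 < 4 - κ ^ 2 * Real.cos θ ^ 2 := by nlinarith [sq_nonneg κ, sq_nonneg (Real.cos θ)]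
  field_simp

lemma integral_kestenPoly_kestenMeasure (hl0 : 0 < l) (hl1 : l < 1)
    (hκ : κ ∈ Set.Ioo (0 : ℝ) 2) (hκ' : κ ^ 2 = 4 * (l * (2 - l))) (n : ℕ) :
    ∫ x, (kestenPoly l n).eval (x ^ 2) ∂kestenMeasure l κ = if n = 0 then 1 else 0 := by
  rw [integral_kestenMeasure_comp_sq hl0 hκ (kestenPoly l n).continuous,
    integral_kestenPoly hl0 hl1 hκ']
  split_ifs
  · have : 2 - l ≠ 0 := by linarith
    have := Real.pi_ne_zero
    rw [hκ']
    field_simp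
  · rw [mul_zero]

lemma isProbabilityMeasure_kestenMeasure (hl0 : 0 < l) (hl1 : l < 1)
    (hκ : κ ∈ Set.Ioo (0 : ℝ) 2) (hκ' : κ ^ 2 = 4 * (l * (2 - l))) :
    IsProbabilityMeasure (kestenMeasure l κ) := by
  constructor
  have h := integral_kestenPoly_kestenMeasure hl0 hl1 hκ hκ' 0
  rw [if_pos rfl] at h
  simp only [kestenPoly, Polynomial.eval_one] at h
  rw [integral_kestenMeasure hl0 hκ] at h
  simp only [mul_one] at h
  rw [kestenMeasure, withDensity_apply _ MeasurableSet.univ, setLIntegral_univ,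
    ← ofReal_integral_eq_lintegral_ofReal, h, ENNReal.ofReal_one]
  · exact (continuousOn_kestenDensity hl0 hκ).integrableOn_compact (isCompact_kestenSupport κ)
  · exact (ae_restrict_iff' (isCompact_kestenSupport κ).measurableSet).mpr
      (ae_of_all _ fun x hx => kestenDensity_nonneg hl0 hκ hx)

/-- The density is positive on the two open intervals, whose closure is the whole set. Every
neighbourhood of a point of the set therefore meets them in positive Lebesgue measure. -/
lemma support_kestenMeasure (hl0 : 0 < l) (hκ : κ ∈ Set.Ioo (0 : ℝ) 2) :
    (kestenMeasure l κ).support = kestenSupport κ := by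
  have hmeas := (isCompact_kestenSupport κ).measurableSet
  apply Set.Subset.antisymm
  · refine Measure.support_subset_of_isClosed (isCompact_kestenSupport κ).isClosed ?_
    exact withDensity_absolutelyContinuous _ _ (ae_restrict_mem hmeas)
  · set a := √(2 - κ) with ha
    set b := √(2 + κ) with hb
    obtain ⟨hκ0, hκ2⟩ := hκ
    have ha0 : 0 < a := Real.sqrt_pos.mpr (by linarith)
    have hab : a < b := Real.sqrt_lt_sqrt (by linarith) (by linarith)
    set U := Set.Ioo (-b) (-a) ∪ Set.Ioo a b with hU
    have hUo : IsOpen U := isOpen_Ioo.union isOpen_Ioo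
    have hcl : closure U = kestenSupport κ := by
      rw [hU, closure_union, closure_Ioo (by linarith), closure_Ioo hab.ne, kestenSupport]
    have hpos : ∀ x ∈ U, 0 < kestenDensity l κ x := by
      intro x hx
      have hx2 : a ^ 2 < x ^ 2 ∧ x ^ 2 < b ^ 2 := by
        rcases hx with hx | hx
        · exact ⟨by nlinarith [hx.1, hx.2], by nlinarith [hx.1, hx.2]⟩
        · exact ⟨by nlinarith [hx.1, hx.2], by nlinarith [hx.1, hx.2]⟩
      have hx0 : x ≠ 0 := by
        rintro rfl
        nlinarith [hx2.1]
      rw [ha, hb, Real.sq_sqrt (by linarith), Real.sq_sqrt (by linarith)] at hx2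
      have h1 : 0 < 4 - x ^ 2 := by linarith [hx2.2]
      have h2 : 0 < κ ^ 2 - (x ^ 2 - 2) ^ 2 := by nlinarith [hx2.1, hx2.2]
      have h3 := Real.sqrt_pos.mpr h2
      have := Real.pi_pos
      unfold kestenDensity
      positivity
    intro x hx
    rw [Measure.mem_support_iff_forall]
    intro V hV
    obtain ⟨O, hOV, hO, hxO⟩ := mem_nhds_iff.mp hV
    rw [← hcl] at hx
    have hne : (O ∩ U).Nonempty := mem_closure_iff.mp hx O hO hxO
    have hvol : 0 < volume (O ∩ U) := (hO.inter hUo).measure_pos volume hne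
    have hUK : U ⊆ kestenSupport κ := hcl ▸ subset_closure
    refine lt_of_lt_of_le ?_ (measure_mono (Set.inter_subset_left.trans hOV : O ∩ U ⊆ V))
    rw [pos_iff_ne_zero, Ne, kestenMeasure,
      withDensity_apply_eq_zero (measurable_kestenDensity l κ).ennreal_ofReal,
      Set.inter_eq_right.mpr, Measure.restrict_apply (hO.inter hUo).measurableSet,
      Set.inter_eq_left.mpr (Set.inter_subset_right.trans hUK)]
    · exact hvol.ne'
    · intro y hy
      exact (ENNReal.ofReal_pos.mpr (hpos y hy.2)).ne'

lemma isSymmCompactProb_kestenMeasure (hl0 : 0 < l) (hl1 : l < 1)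
    (hκ : κ ∈ Set.Ioo (0 : ℝ) 2) (hκ' : κ ^ 2 = 4 * (l * (2 - l))) :
    IsSymmCompactProb (kestenMeasure l κ) where
  prob := isProbabilityMeasure_kestenMeasure hl0 hl1 hκ hκ'
  symm := by
    have hK : MeasurableSet (kestenSupport κ) := (isCompact_kestenSupport κ).measurableSet
    ext s hs
    have hs' : MeasurableSet ((fun x : ℝ => -x) ⁻¹' s) := measurable_neg hs
    rw [Measure.map_apply measurable_neg hs, kestenMeasure, withDensity_apply _ hs',
      withDensity_apply _ hs, Measure.restrict_restrict hs', Measure.restrict_restrict hs]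
    have hpre : (fun x : ℝ => -x) ⁻¹' s ∩ kestenSupport κ =
        (fun x : ℝ => -x) ⁻¹' (s ∩ kestenSupport κ) := by
      ext x
      simp [neg_mem_kestenSupport]
    rw [hpre]
    have := (Measure.measurePreserving_neg (volume : Measure ℝ)).setLIntegral_comp_preimage
      (hs.inter hK) (measurable_kestenDensity l κ).ennreal_ofReal
    rw [← this]
    simp only [kestenDensity_neg]
  compact := by
    rw [support_kestenMeasure hl0 hκ]
    exact isCompact_kestenSupport κ

/-! ### Uniqueness -/

/-- The values of the Kesten polynomials determine the moments of all realizations. -/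
lemma φ_aeval_eq {A : Type*} [Ring A] [StarRing A] [Algebra ℂ A] [StarModule ℂ A]
    (hl0 : 0 < l) (hl1 : l < 1) (hκ : κ ∈ Set.Ioo (0 : ℝ) 2) (hκ' : κ ^ 2 = 4 * (l * (2 - l)))
    (S : RectProbSpace ![l / (1 + l), 1 / (1 + l)] A)
    {a : Fin 2 → A} (hcorner : ∀ i, S.p 0 * a i * S.p 1 = a i) (hfree : S.FreeSets (fun i => {a i}))
    (h : ∀ i r, S.φ 0 ((a i * star (a i)) ^ r) = 1) (r : ℕ) :
    S.φ 0 (((a 0 + a 1) * star (a 0 + a 1)) ^ r) =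
      ((∫ x, x ^ (2 * r) ∂kestenMeasure l κ : ℝ) : ℂ) := by
  have hprob := isSymmCompactProb_kestenMeasure hl0 hl1 hκ hκ'
  have := hprob.prob
  let f : Polynomial ℝ →ₗ[ℝ] ℂ := ((S.φ 0).restrictScalars ℝ).comp
    (Polynomial.aeval (R := ℝ) ((a 0 + a 1) * star (a 0 + a 1))).toLinearMap
  let g : Polynomial ℝ →ₗ[ℝ] ℂ :=
    Complex.ofRealCLM.toLinearMap.comp (evenMoments (kestenMeasure l κ) hprob.compact)
  have hfg : f = g := by
    refine linearMap_ext_kestenPoly l fun n => ?_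
    have h1 : f (kestenPoly l n) = if n = 0 then 1 else 0 :=
      S.φ_kestenPoly hl0 hcorner hfree (fun i => by simpa using h i 1) (fun i => h i 2) n
    have h2 : g (kestenPoly l n) =
        ((∫ x, (kestenPoly l n).eval (x ^ 2) ∂kestenMeasure l κ : ℝ) : ℂ) := rfl
    rw [h1, h2, integral_kestenPoly_kestenMeasure hl0 hl1 hκ hκ']
    split_ifs <;> simp
  have h1 := LinearMap.congr_fun hfg (Polynomial.X ^ r)
  have h2 : f (Polynomial.X ^ r) = S.φ 0 (((a 0 + a 1) * star (a 0 + a 1)) ^ r) := by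
    simp [f]
  have h3 : g (Polynomial.X ^ r) = ((∫ x, x ^ (2 * r) ∂kestenMeasure l κ : ℝ) : ℂ) := by
    simp [g, evenMoments, ← pow_mul]
  rw [← h2, h1, h3]

lemma integral_even_pow_symmBernoulli (r : ℕ) : ∫ x, x ^ (2 * r) ∂symmBernoulli = 1 := by
  rw [integral_symmBernoulli, one_pow, pow_mul]
  norm_num

lemma IsRectFreeConv.eq_kestenMeasure (hl0 : 0 < l) (hl1 : l < 1) (hκ : κ ∈ Set.Ioo (0 : ℝ) 2)
    (hκ' : κ ^ 2 = 4 * (l * (2 - l))) {μ : Measure ℝ}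
    (h : IsRectFreeConv l symmBernoulli symmBernoulli μ) : μ = kestenMeasure l κ := by
  obtain ⟨-, -, hμ, A, _, _, _, _, S, a, hcorner, hfree, h0, h1, h2⟩ := h
  refine hμ.eq_of_even_moments (isSymmCompactProb_kestenMeasure hl0 hl1 hκ hκ') fun r => ?_
  have hm : ∀ i r, S.φ 0 ((a i * star (a i)) ^ r) = 1 := by
    intro i r
    fin_cases i
    · simpa [integral_even_pow_symmBernoulli] using h0 r
    · simpa [integral_even_pow_symmBernoulli] using h1 r
  have := φ_aeval_eq hl0 hl1 hκ hκ' S hcorner hfree hm r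
  rw [h2] at this
  exact_mod_cast this

end Kesten

/-! ### Matrices commuting with a diagonal matrix of projections -/

section Corner

variable {N : Type*} [Ring N] [StarRing N] [Algebra ℂ N] [StarModule ℂ N] {d : ℕ}

/-- The matrices commuting with the diagonal matrix with entries `q`. -/
def cornerAlgebra (q : Fin d → N) : StarSubalgebra ℂ (Matrix (Fin d) (Fin d) N) :=
  StarSubalgebra.centralizer ℂ {Matrix.diagonal q}

/-- Taking a centralizer instead of compressing by the diagonal matrix keeps the identity matrix as
unit. The part cut off by `1 - q k` is invisible to the states, which multiply by `q k`. -/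
lemma mem_cornerAlgebra {q : Fin d → N} (hq : ∀ k, star (q k) = q k)
    {x : Matrix (Fin d) (Fin d) N} :
    x ∈ cornerAlgebra q ↔ ∀ i j, q i * x i j = x i j * q j := by
  have hs : star (Matrix.diagonal q) = Matrix.diagonal q := by
    rw [Matrix.star_eq_conjTranspose, Matrix.diagonal_conjTranspose]
    congr 1
    exact funext hq
  rw [cornerAlgebra, StarSubalgebra.mem_centralizer_iff]
  simp only [Set.mem_singleton_iff, forall_eq, hs, and_self]
  rw [← Matrix.ext_iff]
  simp

/-- The diagonal matrix units. -/
def diagUnit (q : Fin d → N) (hq : ∀ k, star (q k) = q k) (k : Fin d) : cornerAlgebra q :=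
  ⟨Matrix.diagonal fun i => if i = k then 1 else 0, (mem_cornerAlgebra hq).mpr fun i j => by
    by_cases hij : i = j
    · subst hij
      by_cases hik : i = k <;> simp [hik]
    · simp [Matrix.diagonal_apply_ne _ hij]⟩

lemma diagUnit_mul_apply {q : Fin d → N} {hq : ∀ k, star (q k) = q k} (k : Fin d)
    (x : cornerAlgebra q) (i j : Fin d) :
    (diagUnit q hq k * x : cornerAlgebra q).1 i j = if i = k then x.1 i j else 0 := by
  change (Matrix.diagonal (fun m => if m = k then (1 : N) else 0) * x.1 : Matrix _ _ N) i j = _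
  rw [Matrix.diagonal_mul]
  simp

lemma mul_diagUnit_apply {q : Fin d → N} {hq : ∀ k, star (q k) = q k} (k : Fin d)
    (x : cornerAlgebra q) (i j : Fin d) :
    (x * diagUnit q hq k : cornerAlgebra q).1 i j = if j = k then x.1 i j else 0 := by
  change (x.1 * Matrix.diagonal (fun m => if m = k then (1 : N) else 0) : Matrix _ _ N) i j = _
  rw [Matrix.mul_diagonal]
  simp

lemma corner_mul_apply {q : Fin d → N} {hq : ∀ k, star (q k) = q k} {k l : Fin d}
    {x y : cornerAlgebra q} (hx : diagUnit q hq k * x * diagUnit q hq l = x) :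
    (x * y).1 k k = x.1 k l * y.1 l k := by
  change (x.1 * y.1) k k = _
  rw [Matrix.mul_apply, Finset.sum_eq_single l]
  · intro m _ hm
    have : x.1 k m = 0 := by rw [← hx, mul_diagUnit_apply, if_neg hm]
    rw [this, zero_mul]
  · simp

/-- The rectangular probability space of matrices commuting with a diagonal matrix of projections,
over a tracial `*`-algebra. -/
noncomputable def cornerSpace {ρ : Fin d → ℝ} (q : Fin d → N) (hq : ∀ k, star (q k) = q k)
    (hqq : ∀ k, q k * q k = q k) (τ : N →ₗ[ℂ] ℂ)
    (hpos : ∀ x, 0 ≤ (τ (star x * x)).re ∧ (τ (star x * x)).im = 0)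
    (htr : ∀ x y, τ (x * y) = τ (y * x)) {c : ℝ}
    (hρ : ∀ k, 0 < c * ρ k) (hτ : ∀ k, τ (q k) = ((c * ρ k : ℝ) : ℂ)) :
    RectProbSpace ρ (cornerAlgebra q) where
  p := diagUnit q hq
  -- By `hτ` the number `c * ρ k` is the trace of `q k`, so the functional is normalized, and the
  -- common `c` drops out of the exchange relation.
  φ k :=
    { toFun x := ((c * ρ k : ℝ) : ℂ)⁻¹ * τ (q k * x.1 k k)
      map_add' x y := by
        change _ * τ (q k * (x.1 k k + y.1 k k)) = _
        rw [mul_add, map_add, mul_add]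
      map_smul' r x := by
        change _ * τ (q k * (r • x.1 k k)) = r * _
        rw [mul_smul_comm, map_smul, smul_eq_mul]
        ring }
  p_ne_zero k h := by
    have h1 : (diagUnit q hq k).1 k k = 0 := by rw [h]; rfl
    simp only [diagUnit, Matrix.diagonal_apply_eq, if_pos] at h1
    have h2 : τ (q k) = 0 := by rw [← mul_one (q k), h1, mul_zero, map_zero]
    rw [hτ] at h2
    exact (hρ k).ne' (by exact_mod_cast h2)
  p_selfAdjoint k := by
    refine Subtype.ext ?_
    change star (Matrix.diagonal _) = Matrix.diagonal _
    rw [Matrix.star_eq_conjTranspose, Matrix.diagonal_conjTranspose]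
    congr 1
    ext i
    by_cases h : i = k <;> simp [h]
  p_idem k := by
    refine Subtype.ext (Matrix.ext fun i j => ?_)
    rw [diagUnit_mul_apply]
    by_cases hij : i = j
    · subst hij
      by_cases hik : i = k <;> simp [diagUnit, hik]
    · simp [diagUnit, Matrix.diagonal_apply_ne _ hij]
  p_orthogonal k l hkl := by
    refine Subtype.ext (Matrix.ext fun i j => ?_)
    rw [diagUnit_mul_apply]
    by_cases hij : i = j
    · subst hij
      by_cases hik : i = k
      · subst hik; simp [diagUnit, hkl]
      · simp [hik]
    · simp [diagUnit, Matrix.diagonal_apply_ne _ hij]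
  p_sum := by
    refine Subtype.ext (Matrix.ext fun i j => ?_)
    rw [AddSubmonoidClass.coe_finsetSum, Matrix.sum_apply]
    by_cases hij : i = j
    · subst hij; simp [diagUnit]
    · simp [diagUnit, Matrix.diagonal_apply_ne _ hij, Matrix.one_apply_ne hij]
  φ_compress k x := by
    simp only [LinearMap.coe_mk, AddHom.coe_mk]
    rw [mul_diagUnit_apply, diagUnit_mul_apply, if_pos rfl, if_pos rfl]
  φ_unital k := by
    simp only [LinearMap.coe_mk, AddHom.coe_mk, diagUnit, Matrix.diagonal_apply_eq, if_pos,
      mul_one, hτ]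
    exact inv_mul_cancel₀ (by exact_mod_cast (hρ k).ne')
  φ_pos k x _ := by
    simp only [LinearMap.coe_mk, AddHom.coe_mk]
    -- Traciality and `q k * q k = q k` place a copy of `q k` on each side, giving a sum of squares
    -- over the `k`-th column.
    have e : τ (q k * (star x * x).1 k k) =
        ∑ j, τ (star (x.1 j k * q k) * (x.1 j k * q k)) := by
      change τ (q k * (star x.1 * x.1) k k) = _
      rw [Matrix.mul_apply, Finset.mul_sum, map_sum]
      refine Finset.sum_congr rfl fun j _ => ?_
      have h (y : N) : τ (q k * (star y * y)) = τ (star (y * q k) * (y * q k)) := by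
        have h1 : star (y * q k) * (y * q k) = q k * (star y * y * q k) := by
          rw [star_mul, hq]
          simp only [mul_assoc]
        rw [h1, htr _ (star y * y * q k), mul_assoc (star y * y), hqq, htr]
      exact h _
    rw [e, ← Complex.ofReal_inv, Complex.re_ofReal_mul, Complex.im_ofReal_mul, Complex.re_sum,
      Complex.im_sum]
    refine ⟨mul_nonneg (inv_nonneg.mpr (hρ k).le) (Finset.sum_nonneg fun j _ => (hpos _).1), ?_⟩
    rw [Finset.sum_eq_zero fun j _ => (hpos _).2, mul_zero]
  φ_tracial k x y hx hy := by
    simp only [LinearMap.coe_mk, AddHom.coe_mk]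
    rw [corner_mul_apply hx, corner_mul_apply hy, ← mul_assoc,
      (mem_cornerAlgebra hq).mp x.2 k k, mul_assoc, htr, mul_assoc]
  φ_exchange k l x y hx hy := by
    simp only [LinearMap.coe_mk, AddHom.coe_mk]
    rw [corner_mul_apply hx, corner_mul_apply hy, ← mul_assoc (q k),
      (mem_cornerAlgebra hq).mp x.2 k l, mul_assoc (x.1 k l), htr, mul_assoc (q l)]
    have h1 (k) : (ρ k : ℂ) * ((c * ρ k : ℝ) : ℂ)⁻¹ = (c : ℂ)⁻¹ := by
      have h3 : (ρ k : ℂ) ≠ 0 := by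
        intro h
        have h4 : ρ k = 0 := by exact_mod_cast h
        have := hρ k
        rw [h4, mul_zero] at this
        exact lt_irrefl _ this
      push_cast
      rw [mul_inv, mul_left_comm, mul_inv_cancel₀ h3, mul_one]
    rw [← mul_assoc (ρ k : ℂ), ← mul_assoc (ρ l : ℂ), h1, h1]

end Corner

/-! ### Reduced words -/

section Words

variable {N : Type*} [Ring N] [Algebra ℂ N] {I : Type*}

/-- The span of the products along reduced words in the letters `e i` whose first letter belongs
to `H`. -/
def wordSpan (e : I → N) (H : Set (Option I)) : Submodule ℂ N :=
  Submodule.span ℂ {x | ∃ w : List I, w.IsChain (· ≠ ·) ∧ w.head? ∈ H ∧ (w.map e).prod = x}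

lemma one_mem_wordSpan (e : I → N) {H : Set (Option I)} (h : none ∈ H) : 1 ∈ wordSpan e H :=
  Submodule.subset_span ⟨[], by simp, by simpa, by simp⟩

/-- A reduced word stays reduced when preceded by a letter other than its first. The value `none` in
`H` stands for the empty word, so no separate case is needed for it. -/
lemma letter_mul_mem_wordSpan (e : I → N) {H : Set (Option I)} {i : I} (hi : some i ∉ H) {x : N}
    (hx : x ∈ wordSpan e H) : e i * x ∈ wordSpan e {some i} := by
  induction hx using Submodule.span_induction with
  | mem x hx =>
    obtain ⟨w, h1, h2, rfl⟩ := hx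
    refine Submodule.subset_span ⟨i :: w, ?_, by simp, by simp⟩
    rw [List.isChain_cons]
    refine ⟨fun y hy => ?_, h1⟩
    rintro rfl
    rw [Option.mem_def.mp hy] at h2
    exact hi h2
  | zero => simp
  | add x y _ _ hx hy => rw [mul_add]; exact add_mem hx hy
  | smul c x _ hx => rw [mul_smul_comm]; exact Submodule.smul_mem _ _ hx

lemma apply_wordSpan_eq_zero (e : I → N) (τ : N →ₗ[ℂ] ℂ)
    (hτ : ∀ w : List I, w ≠ [] → w.IsChain (· ≠ ·) → τ (w.map e).prod = 0) {i : I} {x : N}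
    (hx : x ∈ wordSpan e {some i}) : τ x = 0 := by
  induction hx using Submodule.span_induction with
  | mem x hx =>
    obtain ⟨w, h1, h2, rfl⟩ := hx
    refine hτ w ?_ h1
    rintro rfl
    simp at h2
  | zero => simp
  | add x y _ _ hx hy => rw [map_add, hx, hy, add_zero]
  | smul c x _ hx => rw [map_smul, hx, smul_zero]

end Words

/-! ### Free coisometries -/

section Pencil

variable {N : Type*} [Ring N] [Algebra ℂ N]

/-- Elements of the algebra generated by the diagonal and the matrix with upper right entry
`q * e`, where `q` is a projection and `e` a symmetry. -/
def pencil (q e : N) (α β γ δ ε ζ : ℂ) : Matrix (Fin 2) (Fin 2) N :=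
  !![α • 1 + β • q, γ • (q * e); δ • (e * q), ε • 1 + ζ • (e * q * e)]

/-- Since `(q * e) * (e * q) = q` and `(e * q) * (q * e) = e * q * e`, six coefficients suffice to
describe an algebra. -/
lemma pencil_mul_pencil {q e : N} (hqq : q * q = q) (hee : e * e = 1)
    (α β γ δ ε ζ α' β' γ' δ' ε' ζ' : ℂ) :
    pencil q e α β γ δ ε ζ * pencil q e α' β' γ' δ' ε' ζ' =
      pencil q e (α * α') (α * β' + β * α' + β * β' + γ * δ') (α * γ' + β * γ' + γ * ε' + γ * ζ')
        (δ * α' + δ * β' + ε * δ' + ζ * δ') (ε * ε') (δ * γ' + ε * ζ' + ζ * ε' + ζ * ζ') := by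
  have hq (x : N) : q * (q * x) = q * x := by rw [← mul_assoc, hqq]
  have he (x : N) : e * (e * x) = x := by rw [← mul_assoc, hee, one_mul]
  rw [pencil, pencil, pencil, Matrix.mul_fin_two]
  congr 1
  ext i j
  fin_cases i <;> fin_cases j <;>
  · simp [mul_add, add_mul, mul_assoc, hq, he, hqq, smul_smul]
    module

lemma pencil_add_pencil (q e : N) (α β γ δ ε ζ α' β' γ' δ' ε' ζ' : ℂ) :
    pencil q e α β γ δ ε ζ + pencil q e α' β' γ' δ' ε' ζ' =
      pencil q e (α + α') (β + β') (γ + γ') (δ + δ') (ε + ε') (ζ + ζ') := by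
  ext i j
  fin_cases i <;> fin_cases j <;> simp [pencil] <;> module

lemma algebraMap_eq_pencil (q e : N) (r : ℂ) :
    algebraMap ℂ (Matrix (Fin 2) (Fin 2) N) r = pencil q e r 0 0 0 r 0 := by
  ext i j
  fin_cases i <;> fin_cases j <;>
    simp [pencil, Matrix.algebraMap_matrix_apply, Algebra.algebraMap_eq_smul_one]

end Pencil

section Coisometries

variable {N : Type*} [Ring N] [StarRing N]

lemma star_corner_projections {q : N} (hq : star q = q) (k : Fin 2) :
    star ((![q, 1] : Fin 2 → N) k) = ![q, 1] k := by
  fin_cases k <;> simp [hq]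

variable [Algebra ℂ N] [StarModule ℂ N]

lemma star_pencil {q e : N} (hq : star q = q) (he : star e = e) (α β γ δ ε ζ : ℂ) :
    star (pencil q e α β γ δ ε ζ) =
      pencil q e (star α) (star β) (star δ) (star γ) (star ε) (star ζ) := by
  ext i j
  fin_cases i <;> fin_cases j <;> simp [pencil, Matrix.star_apply, hq, he, mul_assoc]

lemma pencil_mem_cornerAlgebra {q e : N} (hq : star q = q) (hqq : q * q = q) (α β γ δ ε ζ : ℂ) :
    pencil q e α β γ δ ε ζ ∈ cornerAlgebra ![q, 1] := by
  rw [mem_cornerAlgebra (star_corner_projections hq)]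
  have hq (x : N) : q * (q * x) = q * x := by rw [← mul_assoc, hqq]
  intro i j
  fin_cases i <;> fin_cases j <;> simp [pencil, mul_add, add_mul, hq, hqq, mul_assoc]

/-- The `*`-algebra generated by the diagonal and the matrix with upper right entry `q * e`. -/
def pencilAlgebra {q e : N} (hq : star q = q) (hqq : q * q = q) (he : star e = e)
    (hee : e * e = 1) : StarSubalgebra ℂ (cornerAlgebra ![q, 1]) where
  carrier := {x | ∃ α β γ δ ε ζ : ℂ, x.1 = pencil q e α β γ δ ε ζ}
  mul_mem' := by
    rintro x y ⟨α, β, γ, δ, ε, ζ, hx⟩ ⟨α', β', γ', δ', ε', ζ', hy⟩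
    exact ⟨_, _, _, _, _, _, (congrArg₂ (· * ·) hx hy).trans
      (pencil_mul_pencil hqq hee _ _ _ _ _ _ _ _ _ _ _ _)⟩
  add_mem' := by
    rintro x y ⟨α, β, γ, δ, ε, ζ, hx⟩ ⟨α', β', γ', δ', ε', ζ', hy⟩
    exact ⟨_, _, _, _, _, _, (congrArg₂ (· + ·) hx hy).trans
      (pencil_add_pencil q e _ _ _ _ _ _ _ _ _ _ _ _)⟩
  algebraMap_mem' r := ⟨r, 0, 0, 0, r, 0, algebraMap_eq_pencil q e r⟩
  star_mem' := by
    rintro x ⟨α, β, γ, δ, ε, ζ, hx⟩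
    exact ⟨_, _, _, _, _, _, (congrArg star hx).trans (star_pencil hq he _ _ _ _ _ _)⟩

/-- A tracial `*`-algebra with free self-adjoint elements `e none`, `e (some 0)`, `e (some 1)`, the
last two of square one, and a projection in the span of `1` and `e none` provides a realization of
the convolution of two symmetric Bernoulli distributions. -/
theorem exists_free_coisometries {l : ℝ} (hl : 0 < l) (τ : N →ₗ[ℂ] ℂ)
    (hpos : ∀ x, 0 ≤ (τ (star x * x)).re ∧ (τ (star x * x)).im = 0)
    (htr : ∀ x y, τ (x * y) = τ (y * x)) (hone : τ 1 = 1) (e : Option (Fin 2) → N)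
    (hs : ∀ i, star (e i) = e i) (hee : ∀ j, e (some j) * e (some j) = 1)
    (hfree : ∀ w : List (Option (Fin 2)), w ≠ [] → w.IsChain (· ≠ ·) → τ (w.map e).prod = 0)
    {q : N} (hq : star q = q) (hqq : q * q = q) {c : ℂ} (hqe : q = (l : ℂ) • 1 + c • e none) :
    ∃ (S : RectProbSpace ![l / (1 + l), 1 / (1 + l)] (cornerAlgebra ![q, 1]))
      (a : Fin 2 → cornerAlgebra ![q, 1]),
      (∀ i, S.p 0 * a i * S.p 1 = a i) ∧ S.FreeSets (fun i => {a i}) ∧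
      ∀ i r, S.φ 0 ((a i * star (a i)) ^ r) = 1 := by
  have hl' : 0 < 1 + l := by linarith
  have hτq : τ q = l := by
    have := hfree [none] (by simp) (by simp)
    simp only [List.map_cons, List.map_nil, List.prod_cons, List.prod_nil, mul_one] at this
    rw [hqe, map_add, map_smul, map_smul, hone, this]
    simp
  have hlne : (l : ℂ) ≠ 0 := by exact_mod_cast hl.ne'
  let S : RectProbSpace ![l / (1 + l), 1 / (1 + l)] (cornerAlgebra ![q, 1]) :=
    cornerSpace ![q, 1] (star_corner_projections hq)
      (fun k => by fin_cases k <;> simp [hqq]) τ hpos htr (c := 1 + l)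
      (fun k => by fin_cases k <;> simp <;> field_simp <;> linarith)
      (fun k => by
        fin_cases k
        · simp only [Fin.zero_eta, Matrix.cons_val_zero, hτq]
          rw [mul_div_cancel₀ _ hl'.ne']
        · simp only [Fin.mk_one, Matrix.cons_val_one, Matrix.cons_val_fin_one, hone]
          rw [mul_div_cancel₀ _ hl'.ne', Complex.ofReal_one])
  have hφ0 (x : cornerAlgebra ![q, 1]) : S.φ 0 x = (l : ℂ)⁻¹ * τ (q * x.1 0 0) := by
    change (((1 + l) * (l / (1 + l)) : ℝ) : ℂ)⁻¹ * τ (q * x.1 0 0) = _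
    rw [mul_div_cancel₀ _ hl'.ne']
  have hφ1 (x : cornerAlgebra ![q, 1]) : S.φ 1 x = τ (x.1 1 1) := by
    change (((1 + l) * (1 / (1 + l)) : ℝ) : ℂ)⁻¹ * τ (1 * x.1 1 1) = _
    rw [mul_div_cancel₀ _ hl'.ne', one_mul, Complex.ofReal_one, inv_one, one_mul]
  have hp (k) : S.p k = diagUnit ![q, 1] (star_corner_projections hq) k := rfl
  -- The upper right entry is `q * e (some i)`, so `a i * star (a i)` has the single entry `q`,
  -- which `φ 0` cannot distinguish from `1`.
  let a (i : Fin 2) : cornerAlgebra ![q, 1] :=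
    ⟨pencil q (e (some i)) 0 0 1 0 0 0, pencil_mem_cornerAlgebra hq hqq _ _ _ _ _ _⟩
  let B (i : Fin 2) := pencilAlgebra hq hqq (hs (some i)) (hee i)
  refine ⟨S, a, fun i => ?_, ⟨B, ⟨fun i => ?_, ?_⟩, fun i => ?_⟩, fun i r => ?_⟩
  · refine Subtype.ext (Matrix.ext fun m n => ?_)
    rw [hp, hp, mul_diagUnit_apply, diagUnit_mul_apply]
    fin_cases m <;> fin_cases n <;> simp [a, pencil]
  · have : S.diagonal ≤ Subalgebra.toSubmodule (B i).toSubalgebra := by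
      refine Submodule.span_le.mpr ?_
      rintro _ ⟨k, rfl⟩
      rw [hp]
      fin_cases k
      · refine ⟨1, 0, 0, 0, 0, 0, Matrix.ext fun m n => ?_⟩
        fin_cases m <;> fin_cases n <;> simp [diagUnit, pencil]
      · refine ⟨0, 0, 0, 0, 1, 0, Matrix.ext fun m n => ?_⟩
        fin_cases m <;> fin_cases n <;> simp [diagUnit, pencil]
    exact this
  -- Invariant along an alternating product starting with index `j`: the lower row consists of
  -- combinations of reduced words starting with `e (some j)`. So does the upper row, but only after
  -- a left factor `q` has been split off, since `q` itself involves `e none`.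
  · have key (w : List (Fin 2 × cornerAlgebra ![q, 1])) (hw : w.IsChain fun u v => u.1 ≠ v.1)
        (hw' : ∀ u ∈ w, u.2 ∈ B u.1 ∧ S.condExp u.2 = 0) (k : Fin 2) :
        ((w.map Prod.snd).prod.1 1 k ∈ wordSpan e {w.head?.map fun u => some u.1}) ∧
        ∃ y ∈ wordSpan e {w.head?.map fun u => some u.1},
          q * (w.map Prod.snd).prod.1 0 k = q * y := by
      induction w with
      | nil =>
        have h1 : (1 : N) ∈ wordSpan e {none} := one_mem_wordSpan e rfl
        simp only [List.map_nil, List.prod_nil, List.head?_nil, Option.map_none]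
        change (1 : Matrix (Fin 2) (Fin 2) N) 1 k ∈ _ ∧
          ∃ y ∈ _, q * (1 : Matrix (Fin 2) (Fin 2) N) 0 k = q * y
        rw [Matrix.one_apply, Matrix.one_apply]
        fin_cases k
        · exact ⟨by simp, 1, h1, by simp⟩
        · exact ⟨by simpa using h1, 0, zero_mem _, by simp⟩
      | cons u w ih =>
        obtain ⟨j, x⟩ := u
        obtain ⟨⟨⟨α, β, γ, δ, ε, ζ, hx⟩, hE⟩, hw'⟩ := List.forall_mem_cons.mp hw'
        rw [List.isChain_cons] at hw
        obtain ⟨hrow1, y, hy, hrow0⟩ := ih hw.2 hw'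
        have hH : some (some j) ∉ ({w.head?.map fun u => some u.1} : Set _) := by
          intro h
          obtain ⟨v, hv, hv'⟩ := Option.map_eq_some_iff.mp (Set.mem_singleton_iff.mp h).symm
          exact hw.1 v hv (Option.some_injective _ hv').symm
        have hH0 : some none ∉ ({w.head?.map fun u => some u.1} : Set _) := by
          intro h
          obtain ⟨v, hv, hv'⟩ := Option.map_eq_some_iff.mp (Set.mem_singleton_iff.mp h).symm
          simp at hv'
        generalize ({w.head?.map fun u => some u.1} : Set _) = H at *
        simp only [List.map_cons, List.prod_cons, List.head?_cons, Option.map_some]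
        have hmul (i) : (x * (w.map Prod.snd).prod).1 i k =
            x.1 i 0 * (w.map Prod.snd).prod.1 0 k + x.1 i 1 * (w.map Prod.snd).prod.1 1 k := by
          change (x.1 * (w.map Prod.snd).prod.1) i k = _
          rw [Matrix.mul_apply, Fin.sum_univ_two]
        rw [hmul, hmul]
        generalize (w.map Prod.snd).prod.1 0 k = X at *
        generalize (w.map Prod.snd).prod.1 1 k = Y at *
        have hE' := (S.condExp_eq_zero_iff x).mp hE
        -- Centring in the first corner makes `q` annihilate the upper left entry; in the second
        -- corner it removes from the lower right entry the scalar part `l` of `e * q * e`.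
        have hαβ : α + β = 0 := by
          have := hE' 0
          rw [hφ0, hx] at this
          simp only [pencil, Matrix.of_apply, Matrix.cons_val', Matrix.cons_val_zero,
            mul_add, mul_smul_comm, mul_one, hqq, map_add, map_smul, hτq,
            smul_eq_mul, ← add_mul] at this
          simpa [hlne] using this
        have hεζ : ε = -(ζ * l) := by
          have := hE' 1
          rw [hφ1, hx] at this
          simp only [pencil, Matrix.of_apply, Matrix.cons_val', Matrix.cons_val_one,
            Matrix.cons_val_fin_one, map_add, map_smul, smul_eq_mul, hone, mul_one] at this
          rw [htr, ← mul_assoc, hee, one_mul, hτq] at this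
          linear_combination this
        have heY := letter_mul_mem_wordSpan e hH hrow1
        have hjn : some none ∉ ({some (some j)} : Set (Option (Option (Fin 2)))) := by simp
        have hnj : some (some j) ∉ ({some none} : Set (Option (Option (Fin 2)))) := by simp
        rw [hx]
        simp only [pencil, Matrix.of_apply, Matrix.cons_val', Matrix.cons_val_zero,
          Matrix.cons_val_one, Matrix.cons_val_fin_one]
        refine ⟨?_, γ • (e (some j) * Y), Submodule.smul_mem _ _ heY, ?_⟩
        -- Substituting `q = l + c * e none` leaves only products starting with `e (some j)`; the
        -- terms in `Y` alone cancel by `hεζ`.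
        · have e1 : δ • (e (some j) * q) * X + (ε • 1 + ζ • (e (some j) * q * e (some j))) * Y =
              (δ * l) • (e (some j) * y) + (δ * c) • (e (some j) * (e none * y)) +
              (ζ * c) • (e (some j) * (e none * (e (some j) * Y))) := by
            have hY : e (some j) * (e (some j) * Y) = Y := by
              rw [← mul_assoc, hee, one_mul]
            have h1 : e (some j) * q * e (some j) * Y =
                (l : ℂ) • Y + c • (e (some j) * (e none * (e (some j) * Y))) := by
              rw [hqe]
              simp only [mul_add, add_mul, mul_smul_comm, smul_mul_assoc, mul_one, mul_assoc, hY]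
            have h2 : q * y = (l : ℂ) • y + c • (e none * y) := by
              rw [hqe, add_mul, smul_mul_assoc, one_mul, smul_mul_assoc]
            rw [smul_mul_assoc, mul_assoc, hrow0, h2, add_mul, smul_mul_assoc, smul_mul_assoc,
              one_mul, h1, hεζ, mul_add, mul_smul_comm, mul_smul_comm]
            module
          rw [e1]
          refine add_mem (add_mem ?_ ?_) ?_ <;> refine Submodule.smul_mem _ _ ?_
          · exact letter_mul_mem_wordSpan e hH hy
          · exact letter_mul_mem_wordSpan e hnj (letter_mul_mem_wordSpan e hH0 hy)
          · exact letter_mul_mem_wordSpan e hnj (letter_mul_mem_wordSpan e hjn heY)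
        · have h1 : q * ((α • 1 + β • q) * X) = 0 := by
            rw [← mul_assoc, mul_add, mul_smul_comm, mul_smul_comm, mul_one, hqq, ← add_smul, hαβ,
              zero_smul, zero_mul]
          rw [mul_add, h1, zero_add, smul_mul_assoc, mul_smul_comm, mul_smul_comm, mul_assoc,
            ← mul_assoc q q, hqq]
    intro w hne hw hw'
    rw [S.condExp_eq_zero_iff]
    obtain ⟨⟨j, x⟩, w, rfl⟩ := List.exists_cons_of_ne_nil hne
    have hz := fun x => apply_wordSpan_eq_zero e τ hfree (i := some j) (x := x)
    intro k
    fin_cases k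
    · change S.φ 0 _ = 0
      obtain ⟨y, hy, h⟩ := (key _ hw hw' 0).2
      simp only [List.head?_cons, Option.map_some] at hy
      -- `q * y` is a combination of words starting with `e (some j)` and of words starting with `e
      -- none`; both have trace zero.
      rw [hφ0, h, hqe, add_mul, smul_mul_assoc, one_mul, smul_mul_assoc, map_add, map_smul,
        map_smul, hz _ hy, apply_wordSpan_eq_zero e τ hfree
          (letter_mul_mem_wordSpan e (by simp) hy)]
      simp
    · change S.φ 1 _ = 0
      rw [hφ1]
      exact hz _ (key _ hw hw' 1).1
  · rintro _ rfl
    exact ⟨0, 0, 1, 0, 0, 0, rfl⟩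
  · have haa : (a i * star (a i)).1 = pencil q (e (some i)) 0 1 0 0 0 0 := by
      change pencil q (e (some i)) 0 0 1 0 0 0 * star (pencil q (e (some i)) 0 0 1 0 0 0) = _
      rw [star_pencil hq (hs _), pencil_mul_pencil hqq (hee i)]
      simp
    have hpow (r : ℕ) : ((a i * star (a i)) ^ (r + 1)).1 = pencil q (e (some i)) 0 1 0 0 0 0 := by
      induction r with
      | zero => rw [zero_add, pow_one, haa]
      | succ r ih =>
        rw [pow_succ]
        change ((a i * star (a i)) ^ (r + 1)).1 * (a i * star (a i)).1 = _
        rw [ih, haa, pencil_mul_pencil hqq (hee i)]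
        simp
    rcases r with _ | r
    · rw [pow_zero, ← S.φ_mul_p, one_mul, S.φ_unital]
    · rw [hφ0, hpow]
      simp [pencil, hqq, hτq, hlne]

end Coisometries

/-! ### Adjointable operators -/

section Adjointable

variable {W : Type*}

/-- The standard Hermitian form on finitely supported functions. -/
noncomputable def herm (x y : W →₀ ℂ) : ℂ := x.sum fun w a => star a * y w

lemma herm_single_left (w : W) (y : W →₀ ℂ) : herm (Finsupp.single w 1) y = y w := by
  simp [herm]

lemma herm_add_left (x x' y : W →₀ ℂ) : herm (x + x') y = herm x y + herm x' y := by
  classical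
  exact Finsupp.sum_add_index' (by simp) (by simp [add_mul])

lemma herm_smul_left (c : ℂ) (x y : W →₀ ℂ) : herm (c • x) y = star c * herm x y := by
  rw [herm, Finsupp.sum_smul_index' (by simp), herm, Finsupp.mul_sum]
  simp [mul_assoc]

lemma herm_zero_left (y : W →₀ ℂ) : herm 0 y = 0 := by simp [herm]

lemma herm_add_right (x y y' : W →₀ ℂ) : herm x (y + y') = herm x y + herm x y' := by
  simp [herm, mul_add, Finsupp.sum_add]

lemma herm_smul_right (c : ℂ) (x y : W →₀ ℂ) : herm x (c • y) = c * herm x y := by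
  rw [herm, herm, Finsupp.mul_sum]
  refine Finsupp.sum_congr fun w _ => ?_
  rw [Finsupp.smul_apply, smul_eq_mul]
  ring

lemma herm_zero_right (x : W →₀ ℂ) : herm x 0 = 0 := by simp [herm]

lemma star_herm (x y : W →₀ ℂ) : star (herm x y) = herm y x := by
  induction x using Finsupp.induction_linear with
  | zero => simp [herm]
  | add x x' hx hx' => rw [herm_add_left, star_add, hx, hx', herm_add_right]
  | single w a =>
    rw [← mul_one a, ← smul_eq_mul, ← Finsupp.smul_single, herm_smul_left, herm_smul_right,
      herm_single_left, star_mul, star_star, mul_comm]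
    congr 1
    induction y using Finsupp.induction_linear with
    | zero => simp [herm]
    | add y y' hy hy' => rw [herm_add_left, Finsupp.add_apply, star_add, hy, hy']
    | single v b =>
      classical
      simp only [herm, Finsupp.single_apply]
      rw [Finsupp.sum_single_index (by simp)]
      rcases eq_or_ne v w with rfl | h
      · simp
      · simp [h, h.symm]

lemma herm_self (x : W →₀ ℂ) : 0 ≤ (herm x x).re ∧ (herm x x).im = 0 := by
  rw [herm, Finsupp.sum, Complex.re_sum, Complex.im_sum]
  have h (w : W) : star (x w) * x w = ((Complex.normSq (x w) : ℝ) : ℂ) :=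
    Complex.normSq_eq_conj_mul_self.symm
  simp only [h, Complex.ofReal_re, Complex.ofReal_im]
  exact ⟨Finset.sum_nonneg fun w _ => Complex.normSq_nonneg _, Finset.sum_const_zero⟩

lemma ext_herm {x y : W →₀ ℂ} (h : ∀ z, herm z x = herm z y) : x = y := by
  ext w
  rw [← herm_single_left, h, herm_single_left]

variable (W) in
/-- The algebra of operators with an adjoint. -/
def adjointable : Subalgebra ℂ (Module.End ℂ (W →₀ ℂ)) where
  carrier := {S | ∃ T : Module.End ℂ (W →₀ ℂ), ∀ x y, herm (S x) y = herm x (T y)}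
  mul_mem' := by
    rintro S S' ⟨T, hT⟩ ⟨T', hT'⟩
    exact ⟨T' * T, fun x y => by rw [Module.End.mul_apply, Module.End.mul_apply, hT, hT']⟩
  add_mem' := by
    rintro S S' ⟨T, hT⟩ ⟨T', hT'⟩
    exact ⟨T + T', fun x y => by
      rw [LinearMap.add_apply, LinearMap.add_apply, herm_add_left, herm_add_right, hT, hT']⟩
  algebraMap_mem' c := ⟨algebraMap ℂ _ (star c), fun x y => by
    rw [Module.algebraMap_end_apply, Module.algebraMap_end_apply, herm_smul_left,
      herm_smul_right]⟩

lemma exists_adjoint (S : adjointable W) :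
    ∃ T : adjointable W, ∀ x y, herm (S.1 x) y = herm x (T.1 y) := by
  obtain ⟨T, hT⟩ := S.2
  exact ⟨⟨T, S.1, fun x y => by rw [← star_herm, ← hT, star_herm]⟩, hT⟩

noncomputable instance : Ring (adjointable W) := Algebra.semiringToRing ℂ

noncomputable instance : Star (adjointable W) := ⟨fun S => (exists_adjoint S).choose⟩

lemma herm_star (S : adjointable W) (x y : W →₀ ℂ) :
    herm (S.1 x) y = herm x ((star S).1 y) :=
  (exists_adjoint S).choose_spec x y

/-- The form is nondegenerate, so adjoints are unique and the choice made in defining `star` is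
immaterial. -/
lemma star_eq_of_herm {S T : adjointable W} (h : ∀ x y, herm (S.1 x) y = herm x (T.1 y)) :
    star S = T := by
  refine Subtype.ext (LinearMap.ext fun y => ext_herm fun x => ?_)
  rw [← herm_star, h]

noncomputable instance : StarRing (adjointable W) where
  star_involutive S := star_eq_of_herm fun x y => by
    rw [← star_herm, ← herm_star, star_herm]
  star_mul S T := star_eq_of_herm fun x y => by
    change herm (S.1 (T.1 x)) y = herm x ((star T).1 ((star S).1 y))
    rw [herm_star, herm_star]
  star_add S T := star_eq_of_herm fun x y => by
    change herm (S.1 x + T.1 x) y = herm x ((star S).1 y + (star T).1 y)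
    rw [herm_add_left, herm_add_right, herm_star, herm_star]

instance : StarModule ℂ (adjointable W) where
  star_smul c S := star_eq_of_herm fun x y => by
    change herm (c • S.1 x) y = herm x (star c • (star S).1 y)
    rw [herm_smul_left, herm_smul_right, herm_star]

end Adjointable

/-! ### The Hecke algebra of a free product of groups of order two -/

section Hecke

variable {I : Type*}

variable (I) in
/-- Reduced words: lists without equal neighbours. -/
abbrev RedWord : Type _ := {w : List I // w.IsChain (· ≠ ·)}

lemma RedWord.head_cases (i : I) (w : RedWord I) :
    (∃ (t : RedWord I) (h : (i :: t.1).IsChain (· ≠ ·)), w = ⟨i :: t.1, h⟩) ∨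
    (i :: w.1).IsChain (· ≠ ·) := by
  obtain ⟨_ | ⟨j, t⟩, hw⟩ := w
  · right; simp
  · by_cases hij : i = j
    · subst hij
      exact Or.inl ⟨⟨t, (List.isChain_cons.mp hw).2⟩, hw, rfl⟩
    · right
      rw [List.isChain_cons]
      exact ⟨by simpa using hij, hw⟩

lemma RedWord.not_isChain_cons_cons (i : I) (t : List I) : ¬(i :: i :: t).IsChain (· ≠ ·) := by
  simp

open Classical in
/-- The action of a generator on a reduced word. -/
noncomputable def heckeStep (g : I → ℝ) (i : I) (w : RedWord I) : RedWord I →₀ ℂ :=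
  if h : (i :: w.1).IsChain (· ≠ ·) then Finsupp.single ⟨i :: w.1, h⟩ 1
  else Finsupp.single ⟨w.1.tail, w.2.tail⟩ 1 + (g i : ℂ) • Finsupp.single w 1

lemma heckeStep_of_isChain (g : I → ℝ) {i : I} {w : RedWord I}
    (h : (i :: w.1).IsChain (· ≠ ·)) :
    heckeStep g i w = Finsupp.single ⟨i :: w.1, h⟩ 1 := dif_pos h

lemma heckeStep_cons (g : I → ℝ) {i : I} {t : RedWord I} (h : (i :: t.1).IsChain (· ≠ ·)) :
    heckeStep g i ⟨i :: t.1, h⟩ =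
      Finsupp.single t 1 + (g i : ℂ) • Finsupp.single ⟨i :: t.1, h⟩ 1 :=
  dif_neg (RedWord.not_isChain_cons_cons i t.1)

/-- The generator exchanges `w` and `i :: w`, and adds the real diagonal entry `g i` at words
starting with `i`. Its matrix is thus real symmetric, which makes the generator self-adjoint. -/
lemma star_heckeStep_apply (g : I → ℝ) (i : I) (v w : RedWord I) :
    star (heckeStep g i v w) = heckeStep g i w v := by
  classical
  rcases RedWord.head_cases i v with ⟨s, hs, rfl⟩ | hv <;>
    rcases RedWord.head_cases i w with ⟨t, ht, rfl⟩ | hw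
  · have h1 : s ≠ ⟨i :: t.1, ht⟩ := by
      rintro rfl
      exact RedWord.not_isChain_cons_cons i _ hs
    have h2 : t ≠ ⟨i :: s.1, hs⟩ := by
      rintro rfl
      exact RedWord.not_isChain_cons_cons i _ ht
    rw [heckeStep_cons, heckeStep_cons]
    simp only [Finsupp.add_apply, Finsupp.smul_apply, Finsupp.single_apply, if_neg h1, if_neg h2,
      eq_comm (a := (⟨i :: t.1, ht⟩ : RedWord I))]
    split_ifs <;> simp
  · have h1 : i :: s.1 ≠ w.1 := by
      intro h
      rw [← h] at hw
      exact RedWord.not_isChain_cons_cons i _ hw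
    rw [heckeStep_cons, heckeStep_of_isChain g hw]
    simp only [Finsupp.add_apply, Finsupp.smul_apply, Finsupp.single_apply, if_neg h1,
      List.cons.injEq, true_and, Subtype.ext_iff, eq_comm (a := w.1)]
    split_ifs <;> simp
  · have h1 : i :: t.1 ≠ v.1 := by
      intro h
      rw [← h] at hv
      exact RedWord.not_isChain_cons_cons i _ hv
    rw [heckeStep_cons, heckeStep_of_isChain g hv]
    simp only [Finsupp.add_apply, Finsupp.smul_apply, Finsupp.single_apply, if_neg h1,
      List.cons.injEq, true_and, Subtype.ext_iff, eq_comm (a := t.1)]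
    split_ifs <;> simp
  · have h1 : (⟨i :: v.1, hv⟩ : RedWord I) ≠ w := by
      rintro rfl
      exact RedWord.not_isChain_cons_cons i _ hw
    have h2 : (⟨i :: w.1, hw⟩ : RedWord I) ≠ v := by
      rintro rfl
      exact RedWord.not_isChain_cons_cons i _ hv
    rw [heckeStep_of_isChain g hv, heckeStep_of_isChain g hw, Finsupp.single_apply,
      Finsupp.single_apply, if_neg h1, if_neg h2, star_zero]

lemma herm_linearCombination_of_symm {W : Type*} {f : W → W →₀ ℂ}
    (hf : ∀ v w, star (f v w) = f w v) (x y : W →₀ ℂ) :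
    herm (Finsupp.linearCombination ℂ f x) y = herm x (Finsupp.linearCombination ℂ f y) := by
  induction x using Finsupp.induction_linear with
  | zero => simp [herm_zero_left]
  | add x x' hx hx' => rw [map_add, herm_add_left, herm_add_left, hx, hx']
  | single v a =>
    rw [← mul_one a, ← smul_eq_mul, ← Finsupp.smul_single, map_smul, herm_smul_left,
      herm_smul_left]
    congr 1
    induction y using Finsupp.induction_linear with
    | zero => simp [herm_zero_right]
    | add y y' hy hy' => rw [map_add, herm_add_right, herm_add_right, hy, hy']
    | single w b =>
      rw [← mul_one b, ← smul_eq_mul, ← Finsupp.smul_single, map_smul, herm_smul_right,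
        herm_smul_right]
      congr 1
      rw [Finsupp.linearCombination_single, Finsupp.linearCombination_single, one_smul, one_smul,
        ← star_herm, herm_single_left, herm_single_left, hf]

/-- The generators of the Hecke algebra. -/
noncomputable def heckeGen (g : I → ℝ) (i : I) : adjointable (RedWord I) :=
  ⟨Finsupp.linearCombination ℂ (heckeStep g i), Finsupp.linearCombination ℂ (heckeStep g i),
    herm_linearCombination_of_symm (star_heckeStep_apply g i)⟩

lemma star_heckeGen (g : I → ℝ) (i : I) : star (heckeGen g i) = heckeGen g i :=
  star_eq_of_herm (herm_linearCombination_of_symm (star_heckeStep_apply g i))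

lemma heckeGen_single (g : I → ℝ) (i : I) (w : RedWord I) :
    (heckeGen g i).1 (Finsupp.single w 1) = heckeStep g i w := by
  simp [heckeGen]

lemma heckeGen_mul_self (g : I → ℝ) (i : I) :
    heckeGen g i * heckeGen g i = 1 + (g i : ℂ) • heckeGen g i := by
  refine Subtype.ext (Finsupp.lhom_ext' fun w => LinearMap.ext_ring ?_)
  change (heckeGen g i).1 ((heckeGen g i).1 (Finsupp.single w 1)) =
    Finsupp.single w 1 + (g i : ℂ) • (heckeGen g i).1 (Finsupp.single w 1)
  rcases RedWord.head_cases i w with ⟨t, ht, rfl⟩ | hw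
  · rw [heckeGen_single, heckeStep_cons, map_add, map_smul, heckeGen_single, heckeGen_single,
      heckeStep_of_isChain g ht, heckeStep_cons]
  · rw [heckeGen_single, heckeStep_of_isChain g hw, heckeGen_single, heckeStep_cons]

/-- The basis element of the Hecke algebra of a reduced word. -/
noncomputable def heckeWord (g : I → ℝ) (w : List I) : adjointable (RedWord I) :=
  (w.map (heckeGen g)).prod

lemma heckeWord_cons (g : I → ℝ) (i : I) (w : List I) :
    heckeWord g (i :: w) = heckeGen g i * heckeWord g w := by simp [heckeWord]

lemma star_heckeWord (g : I → ℝ) (w : List I) : star (heckeWord g w) = heckeWord g w.reverse := by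
  induction w with
  | nil => simp [heckeWord]
  | cons i w ih =>
    rw [heckeWord_cons, star_mul, ih, star_heckeGen]
    simp [heckeWord]

/-- Read from the right, a reduced word only ever lengthens the vector it acts on, so the branch
with `g` never occurs. Traces of products thereby become inner products of basis vectors. -/
lemma heckeWord_single (g : I → ℝ) (w : RedWord I) :
    (heckeWord g w.1).1 (Finsupp.single ⟨[], by simp⟩ 1) = Finsupp.single w 1 := by
  obtain ⟨w, hw⟩ := w
  induction w with
  | nil => simp [heckeWord]
  | cons i w ih =>
    have hw' := (List.isChain_cons.mp hw).2
    rw [heckeWord_cons]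
    change (heckeGen g i).1 ((heckeWord g w).1 _) = _
    rw [ih hw', heckeGen_single]
    exact heckeStep_of_isChain g (w := ⟨w, hw'⟩) hw

/-- The span of the words. -/
noncomputable def heckeSpan (g : I → ℝ) : Submodule ℂ (adjointable (RedWord I)) :=
  Submodule.span ℂ (Set.range fun w : RedWord I => heckeWord g w.1)

/-- A repeated letter is reduced by the quadratic relation, so the span of the reduced words is
closed under multiplication. -/
lemma heckeGen_mul_mem (g : I → ℝ) (i : I) {x : adjointable (RedWord I)}
    (hx : x ∈ heckeSpan g) : heckeGen g i * x ∈ heckeSpan g := by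
  induction hx using Submodule.span_induction with
  | mem x hx =>
    obtain ⟨w, rfl⟩ := hx
    rcases RedWord.head_cases i w with ⟨t, ht, rfl⟩ | hw
    · simp only [heckeWord_cons]
      rw [← mul_assoc, heckeGen_mul_self, add_mul, one_mul, smul_mul_assoc, ← heckeWord_cons]
      exact add_mem (Submodule.subset_span ⟨t, rfl⟩)
        (Submodule.smul_mem _ _ (Submodule.subset_span ⟨⟨i :: t.1, ht⟩, rfl⟩))
    · rw [← heckeWord_cons]
      exact Submodule.subset_span ⟨⟨i :: w.1, hw⟩, rfl⟩
  | zero => simp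
  | add x y _ _ hx hy => rw [mul_add]; exact add_mem hx hy
  | smul c x _ hx => rw [mul_smul_comm]; exact Submodule.smul_mem _ _ hx

lemma heckeWord_mul_mem (g : I → ℝ) (w : List I) {x : adjointable (RedWord I)}
    (hx : x ∈ heckeSpan g) : heckeWord g w * x ∈ heckeSpan g := by
  induction w with
  | nil => simpa [heckeWord] using hx
  | cons i w ih =>
    rw [heckeWord_cons, mul_assoc]
    exact heckeGen_mul_mem g i ih

lemma one_mem_heckeSpan (g : I → ℝ) : 1 ∈ heckeSpan g :=
  Submodule.subset_span ⟨⟨[], by simp⟩, by simp [heckeWord]⟩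

/-- The Hecke algebra, acting on its regular representation. -/
noncomputable def heckeAlgebra (g : I → ℝ) : StarSubalgebra ℂ (adjointable (RedWord I)) where
  carrier := heckeSpan g
  add_mem' := add_mem
  mul_mem' {x y} hx hy := by
    simp only [SetLike.mem_coe] at hx hy ⊢
    induction hx using Submodule.span_induction with
    | mem x hx =>
      obtain ⟨w, rfl⟩ := hx
      exact heckeWord_mul_mem g w.1 hy
    | zero => simp
    | add x x' _ _ hx hx' => rw [add_mul]; exact add_mem hx hx'
    | smul c x _ hx => rw [smul_mul_assoc]; exact Submodule.smul_mem _ _ hx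
  algebraMap_mem' c := by
    rw [Algebra.algebraMap_eq_smul_one]
    exact Submodule.smul_mem _ _ (one_mem_heckeSpan g)
  star_mem' {x} hx := by
    simp only [SetLike.mem_coe] at hx ⊢
    change x ∈ heckeSpan g at hx
    change star x ∈ heckeSpan g
    induction hx using Submodule.span_induction with
    | mem x hx =>
      obtain ⟨w, rfl⟩ := hx
      rw [star_heckeWord]
      refine Submodule.subset_span ⟨⟨w.1.reverse, ?_⟩, rfl⟩
      rw [List.isChain_reverse]
      exact w.2.imp fun _ _ h => h.symm
    | zero => simp
    | add x x' _ _ hx hx' => rw [star_add]; exact add_mem hx hx'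
    | smul c x _ hx => rw [star_smul]; exact Submodule.smul_mem _ _ hx

/-- The vacuum state. -/
noncomputable def vacuumState (I : Type*) : adjointable (RedWord I) →ₗ[ℂ] ℂ where
  toFun x := x.1 (Finsupp.single ⟨[], by simp⟩ 1) ⟨[], by simp⟩
  map_add' _ _ := rfl
  map_smul' _ _ := rfl

lemma vacuumState_one : vacuumState I 1 = 1 := by
  change Finsupp.single (⟨[], by simp⟩ : RedWord I) (1 : ℂ) ⟨[], by simp⟩ = 1
  simp

lemma vacuumState_eq_herm (x : adjointable (RedWord I)) :
    vacuumState I x = herm (Finsupp.single ⟨[], by simp⟩ 1)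
      (x.1 (Finsupp.single ⟨[], by simp⟩ 1)) := (herm_single_left _ _).symm

lemma vacuumState_star_mul_self (x : adjointable (RedWord I)) :
    0 ≤ (vacuumState I (star x * x)).re ∧ (vacuumState I (star x * x)).im = 0 := by
  have : vacuumState I (star x * x) = herm (x.1 (Finsupp.single ⟨[], by simp⟩ 1))
      (x.1 (Finsupp.single ⟨[], by simp⟩ 1)) := by
    rw [vacuumState_eq_herm, herm_star]
    rfl
  rw [this]
  exact herm_self _

open Classical in
lemma vacuumState_heckeWord_mul (g : I → ℝ) (v w : RedWord I) :
    vacuumState I (heckeWord g v.1 * heckeWord g w.1) = if v.1.reverse = w.1 then 1 else 0 := by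
  have hv : v.1.reverse.IsChain (· ≠ ·) := by
    rw [List.isChain_reverse]
    exact v.2.imp fun _ _ h => h.symm
  rw [vacuumState_eq_herm]
  change herm _ ((heckeWord g v.1).1 ((heckeWord g w.1).1 _)) = _
  rw [heckeWord_single, ← star_star (heckeWord g v.1), ← herm_star, star_heckeWord,
    heckeWord_single g ⟨v.1.reverse, hv⟩, herm_single_left, Finsupp.single_apply]
  simp only [Subtype.ext_iff, eq_comm]

/-- On basis words the vacuum state tests whether one is the reverse of the other, which is a
symmetric condition. -/
lemma vacuumState_mul_comm (g : I → ℝ) {x y : adjointable (RedWord I)} (hx : x ∈ heckeSpan g)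
    (hy : y ∈ heckeSpan g) : vacuumState I (x * y) = vacuumState I (y * x) := by
  classical
  induction hx using Submodule.span_induction with
  | mem x hx =>
    obtain ⟨v, rfl⟩ := hx
    induction hy using Submodule.span_induction with
    | mem y hy =>
      obtain ⟨w, rfl⟩ := hy
      rw [vacuumState_heckeWord_mul, vacuumState_heckeWord_mul]
      congr 1
      exact propext ⟨fun h => by rw [← h, List.reverse_reverse],
        fun h => by rw [← h, List.reverse_reverse]⟩
    | zero => simp
    | add y y' _ _ hy hy' => rw [add_mul, mul_add, map_add, map_add, hy, hy']
    | smul c y _ hy => rw [smul_mul_assoc, mul_smul_comm, map_smul, map_smul, hy]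
  | zero => simp
  | add x x' _ _ hx hx' => rw [add_mul, mul_add, map_add, map_add, hx, hx']
  | smul c x _ hx => rw [smul_mul_assoc, mul_smul_comm, map_smul, map_smul, hx]

lemma vacuumState_heckeWord (g : I → ℝ) {w : List I} (hne : w ≠ []) (hw : w.IsChain (· ≠ ·)) :
    vacuumState I (heckeWord g w) = 0 := by
  classical
  have := vacuumState_heckeWord_mul g ⟨[], by simp⟩ ⟨w, hw⟩
  rw [if_neg (by simpa using hne.symm)] at this
  simpa [heckeWord] using this

end Hecke

/-! ### The main theorem -/

lemma isRectFreeConv_kestenMeasure {l κ : ℝ} (hl0 : 0 < l) (hl1 : l < 1)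
    (hκ : κ ∈ Set.Ioo (0 : ℝ) 2) (hκ' : κ ^ 2 = 4 * (l * (2 - l))) :
    IsRectFreeConv l symmBernoulli symmBernoulli (kestenMeasure l κ) := by
  set c : ℝ := √(l * (1 - l)) with hc
  have hc0 : 0 < c := Real.sqrt_pos.mpr (mul_pos hl0 (by linarith))
  have hc2 : c * c = l * (1 - l) := Real.mul_self_sqrt (mul_pos hl0 (by linarith)).le
  -- With `e * e = 1 + g * e`, the element `l + c * e` is idempotent when `c ^ 2 = l * (1 - l)` and
  -- `c * g = 1 - 2 * l`. The value `0` makes the other two generators symmetries.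
  let g : Option (Fin 2) → ℝ := fun i => i.elim ((1 - 2 * l) / c) fun _ => 0
  have hmem (i) : heckeGen g i ∈ heckeAlgebra g := by
    change heckeGen g i ∈ heckeSpan g
    simpa using heckeGen_mul_mem g i (one_mem_heckeSpan g)
  let e (i : Option (Fin 2)) : heckeAlgebra g := ⟨heckeGen g i, hmem i⟩
  let τ : heckeAlgebra g →ₗ[ℂ] ℂ :=
    (vacuumState (Option (Fin 2))).comp (heckeAlgebra g).subtype.toLinearMap
  have hee (i) : e i * e i = 1 + (g i : ℂ) • e i := Subtype.ext (heckeGen_mul_self g i)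
  have hs (i) : star (e i) = e i := Subtype.ext (star_heckeGen g i)
  let q : heckeAlgebra g := (l : ℂ) • 1 + (c : ℂ) • e none
  have hq : star q = q := by
    simp only [q, star_add, star_smul, star_one, hs]
    simp
  have hqq : q * q = q := by
    have h1 : (c : ℂ) * c = l * (1 - l) := by exact_mod_cast hc2
    have h2 : (c : ℂ) * (g none : ℂ) = 1 - 2 * l := by
      have : c * g none = 1 - 2 * l := mul_div_cancel₀ _ hc0.ne'
      exact_mod_cast this
    have h3 : q * q = ((l : ℂ) * l + c * c) • 1 +
        ((c : ℂ) * (2 * l + c * (g none : ℂ))) • e none := by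
      simp only [q, mul_add, add_mul, smul_mul_assoc, mul_smul_comm, one_mul, mul_one, hee]
      module
    rw [h3, h1, h2]
    simp only [q]
    congr 2 <;> ring
  obtain ⟨S, a, h1, h2, h3⟩ := exists_free_coisometries hl0 τ
    (fun x => vacuumState_star_mul_self x.1) (fun x y => vacuumState_mul_comm g x.2 y.2)
    vacuumState_one e hs
    (fun j => by rw [hee]; simp [g])
    (fun w hne hw => by
      have : τ (w.map e).prod = vacuumState _ (heckeWord g w) := by
        change vacuumState _ ((heckeAlgebra g).subtype (w.map e).prod) = _
        rw [map_list_prod, List.map_map]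
        rfl
      rw [this, vacuumState_heckeWord g hne hw]) hq hqq rfl
  exact ⟨isSymmCompactProb_symmBernoulli, isSymmCompactProb_symmBernoulli,
    isSymmCompactProb_kestenMeasure hl0 hl1 hκ hκ', _, inferInstance, inferInstance, inferInstance,
    inferInstance, S, a, h1, h2, fun r => by rw [h3, integral_even_pow_symmBernoulli]; simp,
    fun r => by rw [h3, integral_even_pow_symmBernoulli]; simp,
    φ_aeval_eq hl0 hl1 hκ hκ' S h1 h2 h3⟩

theorem proposition8p3p07 (lam : ℝ) (hlam₀ : 0 < lam) (hlam₁ : lam < 1)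
    (κ : ℝ) (hκ : κ = 2 * √(lam * (2 - lam)))
    (K : Set ℝ) (hK : K = Set.Icc (-√(2 + κ)) (-√(2 - κ)) ∪ Set.Icc (√(2 - κ)) (√(2 + κ)))
    (τ : Measure ℝ) (hτ : τ = rectFreeConv lam symmBernoulli symmBernoulli) :
    κ ∈ Set.Ioo (0 : ℝ) 2 ∧
    IsRectFreeConv lam symmBernoulli symmBernoulli τ ∧
    τ.support = K ∧
    τ = (volume.restrict K).withDensity (fun x =>
      ENNReal.ofReal (√(κ ^ 2 - (x ^ 2 - 2) ^ 2) / (Real.pi * lam * |x| * (4 - x ^ 2)))) := by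
  have hpos : 0 < lam * (2 - lam) := mul_pos hlam₀ (by linarith)
  have hκ' : κ ^ 2 = 4 * (lam * (2 - lam)) := by
    rw [hκ, mul_pow, Real.sq_sqrt hpos.le]; norm_num
  have hκ0 : 0 < κ := by
    rw [hκ]
    have := Real.sqrt_pos.mpr hpos
    positivity
  -- The upper bound holds because `4 - κ ^ 2 = 4 * (1 - lam) ^ 2 > 0`.
  have hκm : κ ∈ Set.Ioo (0 : ℝ) 2 := ⟨hκ0, by nlinarith [sq_pos_of_pos (sub_pos.mpr hlam₁)]⟩
  have hex : ∃ μ, IsRectFreeConv lam symmBernoulli symmBernoulli μ :=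
    ⟨_, isRectFreeConv_kestenMeasure hlam₀ hlam₁ hκm hκ'⟩
  have hconv : IsRectFreeConv lam symmBernoulli symmBernoulli τ := by
    rw [hτ, rectFreeConv, dif_pos hex]
    exact hex.choose_spec
  have hτ' : τ = kestenMeasure lam κ := hconv.eq_kestenMeasure hlam₀ hlam₁ hκm hκ'
  refine ⟨hκm, hconv, ?_, ?_⟩
  · rw [hτ', support_kestenMeasure hlam₀ hκm, hK, kestenSupport]
  · rw [hτ', hK]
    rfl
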